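/- Let $d\ge 0$ be an integer and let $J\in-\frac{d+1}{2}+i\mathbb R$. Put $\bar J:=-J-d-1$, which lies on the same line. Smooth sections of the line bundle of densities $\mathcal L_J$ on $\mathbb P^d$ are the smooth functions $\Psi$ on $\mathbb C^{d+1}\setminus\{0\}$ with $\Psi(\rho x)=|\rho|^{2J}\Psi(x)$ for all $\rho\in\mathbb C\setminus\{0\}$; equivalently, by setting $x_1=0$, they are the translation-invariant functions $\Psi(x_1,\dots,x_{d+2})$ on $\mathbb C^{d+2}$ with the same homogeneity that are smooth off the line $x_1=\dots=x_{d+2}$. Let $\mathcal S_J$ be the space of these smooth sections. In the chart $x_{d+2}\neq0$ a section is represented by the function $\psi$ on $\mathbb C^d$ with $\Psi(x_2,\dots,x_{d+2})=|x_{d+2}|^{2J}\,\psi(x_2/x_{d+2},\dots,x_{d+1}/x_{d+2})$. Let $\mathcal H_J$ be the Hilbert space of square-integrable sections of $\mathcal L_J$ (modulo equality almost everywhere), with norm $\|\Psi\|^2=\int_{\mathbb C^d}|\psi(z)|^2\,d^{2d}z$; it contains $\mathcal S_J$ as a dense subspace. **Theorem.** For each $\Psi\in\mathcal S_J$ there is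 a unique $\widetilde\Psi\in\mathcal S_{\bar J}$ that is the Fourier transform of $\Psi$ in the sense of distributions: both functions define regular distributions on the Schwartz space of $\mathbb C^{d+1}$, and $$\int_{\mathbb C^{d+1}}\widetilde\Psi(k)f(k)\,d^{2(d+1)}k=\int_{\mathbb C^{d+1}}\Psi(x)\,\hat f(x)\,d^{2(d+1)}x,\qquad \hat f(x)=\pi^{-(d+1)}\int_{\mathbb C^{d+1}}f(k)\prod_{r=2}^{d+2}e^{-2i\,\mathrm{Im}(k_rx_r)}\,d^{2(d+1)}k,$$ for all Schwartz functions $f$, where all integrals are with respect to Lebesgue measure. The map $\Psi\mapsto\widetilde\Psi$ is a linear bijection $\mathcal S_J\to\mathcal S_{\bar J}$, it preserves the norm, $$\int_{\mathbb C^d}|\widetilde\psi(z)|^2\,d^{2d}z=\int_{\mathbb C^d}|\psi(z)|^2\,d^{2d}z,$$ and it extends uniquely to a unitary operator $\mathcal H_J\to\mathcal H_{\bar J}$. -/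

import Mathlib

open MeasureTheory
open scoped SchwartzMap ContDiff ComplexConjugate

noncomputable section

namespace ProjectiveFourier

/-- Functions on `ℂ^{d+1} \ {0}` with `Ψ(ρ x) = |ρ|^{2J} Ψ(x)` for all `ρ ∈ ℂ \ {0}`, extended
by zero to the origin. These are the sections of the line bundle of densities `L_J` on `ℙ^d`. -/
def IsHomogeneous {d : ℕ} (J : ℂ) (Ψ : (Fin (d + 1) → ℂ) → ℂ) : Prop :=
  Ψ 0 = 0 ∧ ∀ (ρ : ℂ) (x : Fin (d + 1) → ℂ), ρ ≠ 0 → Ψ (ρ • x) = ((‖ρ‖ : ℂ) ^ (2 * J)) * Ψ x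

lemma IsHomogeneous.add {d : ℕ} {J : ℂ} {Ψ Φ : (Fin (d + 1) → ℂ) → ℂ}
    (h : IsHomogeneous J Ψ) (k : IsHomogeneous J Φ) : IsHomogeneous J (Ψ + Φ) :=
  ⟨by simp [h.1, k.1], fun ρ x hρ => by simp [h.2 ρ x hρ, k.2 ρ x hρ, mul_add]⟩

lemma IsHomogeneous.smul {d : ℕ} {J : ℂ} {Ψ : (Fin (d + 1) → ℂ) → ℂ} (c : ℂ)
    (h : IsHomogeneous J Ψ) : IsHomogeneous J (c • Ψ) :=
  ⟨by simp [h.1], fun ρ x hρ => by simp [h.2 ρ x hρ, mul_left_comm]⟩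

lemma IsHomogeneous.zero {d : ℕ} {J : ℂ} :
    IsHomogeneous J (0 : (Fin (d + 1) → ℂ) → ℂ) := ⟨rfl, fun _ _ _ => by simp⟩

/-- The space of smooth sections of `L_J`. -/
def SmoothSection (d : ℕ) (J : ℂ) : Submodule ℂ ((Fin (d + 1) → ℂ) → ℂ) where
  carrier := {Ψ | IsHomogeneous J Ψ ∧ ContDiffOn ℝ ∞ Ψ {0}ᶜ}
  zero_mem' := ⟨.zero, contDiffOn_const⟩
  add_mem' h k := ⟨h.1.add k.1, h.2.add k.2⟩
  smul_mem' c _ h := ⟨h.1.smul c, h.2.const_smul c⟩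

/-- The line of points of `ℂ^{d+2}` all of whose coordinates agree. -/
def diagonal (d : ℕ) : Set (Fin (d + 2) → ℂ) := {x | ∀ i, x i = x 0}

/-- Translation-invariant functions of `d + 2` complex variables that are homogeneous of degree
`|ρ|^{2J}` and smooth off the diagonal (on which they are set to zero). -/
def TranslationInvariantSection (d : ℕ) (J : ℂ) : Submodule ℂ ((Fin (d + 2) → ℂ) → ℂ) where
  carrier := {Ψ | (∀ (δ : ℂ) (x : Fin (d + 2) → ℂ), Ψ (fun i => x i + δ) = Ψ x) ∧
    IsHomogeneous J Ψ ∧ ContDiffOn ℝ ∞ Ψ (diagonal d)ᶜ}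
  zero_mem' := ⟨fun _ _ => rfl, .zero, contDiffOn_const⟩
  add_mem' h k := ⟨fun δ x => congrArg₂ (· + ·) (h.1 δ x) (k.1 δ x),
    h.2.1.add k.2.1, h.2.2.add k.2.2⟩
  smul_mem' c _ h := ⟨fun δ x => congrArg (c * ·) (h.1 δ x), h.2.1.smul c, h.2.2.const_smul c⟩

lemma slice_mem {d : ℕ} {J : ℂ} {Ψ : (Fin (d + 2) → ℂ) → ℂ}
    (h : Ψ ∈ TranslationInvariantSection d J) :
    (fun x => Ψ (Fin.cons 0 x : Fin (d + 2) → ℂ)) ∈ SmoothSection d J := by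
  obtain ⟨ht, hh, hs⟩ := h
  refine ⟨⟨?_, fun ρ x hρ => ?_⟩, ?_⟩
  · have : (Fin.cons 0 0 : Fin (d + 2) → ℂ) = 0 := by
      ext i; refine Fin.cases ?_ (fun j => ?_) i <;> simp
    simpa [this] using hh.1
  · have : (Fin.cons 0 (ρ • x) : Fin (d + 2) → ℂ) = ρ • (Fin.cons 0 x : Fin (d + 2) → ℂ) := by
      ext i; refine Fin.cases ?_ (fun j => ?_) i <;> simp
    simpa [this] using hh.2 ρ _ hρ
  · refine hs.comp (ContDiff.contDiffOn ?_) ?_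
    · refine contDiff_pi.2 fun i => ?_
      refine Fin.cases ?_ (fun j => ?_) i
      · simpa using contDiff_const
      · simpa using contDiff_apply ℝ ℂ j
    · intro x hx hx'
      refine hx ?_
      ext j
      simpa using hx' j.succ

lemma unslice_mem {d : ℕ} {J : ℂ} {Ψ : (Fin (d + 1) → ℂ) → ℂ} (h : Ψ ∈ SmoothSection d J) :
    (fun x : Fin (d + 2) → ℂ => Ψ (fun i => x i.succ - x 0)) ∈
      TranslationInvariantSection d J := by
  obtain ⟨hh, hs⟩ := h
  refine ⟨fun δ x => by simp, ⟨?_, fun ρ x hρ => ?_⟩, ?_⟩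
  · simpa using (show Ψ (fun _ => 0) = 0 from hh.1)
  · have : (fun i : Fin (d + 1) => (ρ • x) i.succ - (ρ • x) 0)
        = ρ • (fun i : Fin (d + 1) => x i.succ - x 0) := by
      ext i; simp [mul_sub]
    simpa only [this] using hh.2 ρ _ hρ
  · refine hs.comp (ContDiff.contDiffOn ?_) ?_
    · exact contDiff_pi.2 fun i => (contDiff_apply ℝ ℂ i.succ).sub (contDiff_apply ℝ ℂ 0)
    · intro x hx hx'
      refine hx fun i => ?_
      refine Fin.cases rfl (fun j => ?_) i
      exact sub_eq_zero.1 (congrFun hx' j)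

lemma unslice_slice {d : ℕ} {J : ℂ} {Ψ : (Fin (d + 2) → ℂ) → ℂ}
    (h : Ψ ∈ TranslationInvariantSection d J) (x : Fin (d + 2) → ℂ) :
    Ψ (Fin.cons 0 (fun i => x i.succ - x 0) : Fin (d + 2) → ℂ) = Ψ x := by
  rw [← h.1 (-x 0) x]
  congr 1
  ext i
  refine Fin.cases ?_ (fun j => ?_) i <;> simp [sub_eq_add_neg]

/-- A translation-invariant function `Ψ` is represented by the function
`(x₂, …, x_{d+2}) ↦ Ψ(0, x₂, …, x_{d+2})`; this identifies the two kinds of functions. -/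
def reduce (d : ℕ) (J : ℂ) : TranslationInvariantSection d J ≃ₗ[ℂ] SmoothSection d J where
  toFun Ψ := ⟨fun x => Ψ.1 (Fin.cons 0 x : Fin (d + 2) → ℂ), slice_mem Ψ.2⟩
  invFun Ψ := ⟨fun x => Ψ.1 (fun i => x i.succ - x 0), unslice_mem Ψ.2⟩
  map_add' _ _ := rfl
  map_smul' _ _ := rfl
  left_inv Ψ := Subtype.ext (funext fun x => unslice_slice Ψ.2 x)
  right_inv Ψ := by
    ext x
    simp

/-- The function `ψ` on `ℂ^d` that represents a section in the chart where the last coordinate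
does not vanish: `ψ(z) = Ψ(z, 1)`, so that `Ψ(x) = |x_{d+1}|^{2J} ψ(x₁/x_{d+1}, …, x_d/x_{d+1})`. -/
def chart {d : ℕ} (Ψ : (Fin (d + 1) → ℂ) → ℂ) (z : Fin d → ℂ) : ℂ :=
  Ψ (Fin.snoc z 1 : Fin (d + 1) → ℂ)

/-- The homogeneous function represented in the chart by a given function on `ℂ^d`. -/
def ofChart {d : ℕ} (J : ℂ) (ψ : (Fin d → ℂ) → ℂ) (x : Fin (d + 1) → ℂ) : ℂ :=
  if x (Fin.last d) = 0 then 0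
  else ((‖x (Fin.last d)‖ : ℂ) ^ (2 * J)) * ψ (fun i => x i.castSucc / x (Fin.last d))

/-- Square-integrable sections of `L_J`, before sections that agree almost everywhere are
identified. -/
def SquareIntegrable (d : ℕ) (J : ℂ) : Submodule ℂ ((Fin (d + 1) → ℂ) → ℂ) where
  carrier := {Ψ | IsHomogeneous J Ψ ∧ MemLp (chart Ψ) 2 volume}
  zero_mem' := ⟨.zero, MemLp.zero⟩
  add_mem' h k := ⟨h.1.add k.1, h.2.add k.2⟩
  smul_mem' c _ h := ⟨h.1.smul c, h.2.const_smul c⟩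

/-- `SquareIntegrable d J` as a type of its own, so that it does not inherit the topology of
pointwise convergence. -/
def PreHilbertSection (d : ℕ) (J : ℂ) : Type := SquareIntegrable d J

instance (d : ℕ) (J : ℂ) : AddCommGroup (PreHilbertSection d J) :=
  inferInstanceAs (AddCommGroup (SquareIntegrable d J))

instance (d : ℕ) (J : ℂ) : Module ℂ (PreHilbertSection d J) :=
  inferInstanceAs (Module ℂ (SquareIntegrable d J))

/-- A square-integrable section as an element of `PreHilbertSection d J`. -/
def PreHilbertSection.mk {d : ℕ} {J : ℂ} : SquareIntegrable d J →ₗ[ℂ] PreHilbertSection d J :=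
  LinearMap.id (M := SquareIntegrable d J)

/-- The homogeneous function underlying an element of `PreHilbertSection d J`. -/
def PreHilbertSection.fn {d : ℕ} {J : ℂ} :
    PreHilbertSection d J →ₗ[ℂ] ((Fin (d + 1) → ℂ) → ℂ) :=
  (SquareIntegrable d J).subtype

lemma PreHilbertSection.fn_mk {d : ℕ} {J : ℂ} (Ψ : SquareIntegrable d J) :
    (PreHilbertSection.mk Ψ).fn = Ψ.1 := rfl

lemma PreHilbertSection.memLp {d : ℕ} {J : ℂ} (Ψ : PreHilbertSection d J) :
    MemLp (chart Ψ.fn) 2 volume :=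
  (show SquareIntegrable d J from Ψ).2.2

lemma integrable_conj_mul {d : ℕ} {f g : (Fin d → ℂ) → ℂ} (hf : MemLp f 2 volume)
    (hg : MemLp g 2 volume) : Integrable (fun z => conj (f z) * g z) volume :=
  MemLp.integrable_mul hf.star hg

/-- The inner product `∫ conj(ψ₁(z)) ψ₂(z) d^{2d}z`, with Lebesgue measure on `ℂ^d`. -/
instance innerCore (d : ℕ) (J : ℂ) : PreInnerProductSpace.Core ℂ (PreHilbertSection d J) where
  inner Ψ Φ := ∫ z : Fin d → ℂ, conj (chart Ψ.fn z) * chart Φ.fn z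
  conj_inner_symm Ψ Φ := by
    rw [← integral_conj]
    simp [mul_comm]
  re_inner_nonneg Ψ := by
    have : ∀ z : Fin d → ℂ, conj (chart Ψ.fn z) * chart Ψ.fn z
        = ((‖chart Ψ.fn z‖ ^ 2 : ℝ) : ℂ) := fun z => by
      rw [Complex.conj_mul']; simp
    simp only [this]
    rw [integral_complex_ofReal]
    exact integral_nonneg (fun _ => sq_nonneg _)
  add_left Ψ Φ Θ := by
    rw [← integral_add (integrable_conj_mul Ψ.memLp Θ.memLp) (integrable_conj_mul Φ.memLp Θ.memLp)]
    refine integral_congr_ae (.of_forall fun z => ?_)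
    change conj (chart Ψ.fn z + chart Φ.fn z) * chart Θ.fn z = _
    rw [map_add, add_mul]
  smul_left Ψ Φ c := by
    rw [← integral_const_mul]
    refine integral_congr_ae (.of_forall fun z => ?_)
    change conj (c * chart Ψ.fn z) * chart Φ.fn z = _
    rw [map_mul, mul_assoc]

instance (d : ℕ) (J : ℂ) : SeminormedAddCommGroup (PreHilbertSection d J) :=
  InnerProductSpace.Core.toSeminormedAddCommGroup (𝕜 := ℂ)

instance (d : ℕ) (J : ℂ) : InnerProductSpace ℂ (PreHilbertSection d J) :=
  InnerProductSpace.ofCore (innerCore d J)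

/-- The Hilbert space of square-integrable sections of `L_J`. -/
abbrev HilbertSection (d : ℕ) (J : ℂ) : Type := SeparationQuotient (PreHilbertSection d J)

lemma norm_sq_eq {d : ℕ} {J : ℂ} (Ψ : PreHilbertSection d J) :
    ‖Ψ‖ ^ 2 = ∫ z : Fin d → ℂ, ‖chart Ψ.fn z‖ ^ 2 := by
  rw [@norm_sq_eq_re_inner ℂ]
  change (∫ z : Fin d → ℂ, conj (chart Ψ.fn z) * chart Ψ.fn z).re = _
  have : ∀ z : Fin d → ℂ, conj (chart Ψ.fn z) * chart Ψ.fn z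
      = ((‖chart Ψ.fn z‖ ^ 2 : ℝ) : ℂ) := fun z => by
    rw [Complex.conj_mul']; simp
  simp only [this]
  rw [integral_complex_ofReal]
  simp

lemma norm_toLp_eq {d : ℕ} {J : ℂ} (Ψ : PreHilbertSection d J) :
    ‖Ψ.memLp.toLp (chart Ψ.fn)‖ = ‖Ψ‖ := by
  rw [← sq_eq_sq₀ (norm_nonneg _) (norm_nonneg _), norm_sq_eq, @norm_sq_eq_re_inner ℂ,
    L2.inner_def]
  have : (∫ z, inner ℂ (Ψ.memLp.toLp (chart Ψ.fn) z) (Ψ.memLp.toLp (chart Ψ.fn) z))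
      = ∫ z, ((‖chart Ψ.fn z‖ ^ 2 : ℝ) : ℂ) := by
    refine integral_congr_ae ?_
    filter_upwards [Ψ.memLp.coeFn_toLp] with z hz
    rw [hz, inner_self_eq_norm_sq_to_K]
    simp
  rw [this, integral_complex_ofReal]
  simp

/-- A section as an element of `L²(ℂ^d)`. -/
def toLp (d : ℕ) (J : ℂ) :
    PreHilbertSection d J →ₗᵢ[ℂ] Lp ℂ 2 (volume : Measure (Fin d → ℂ)) where
  toFun Ψ := Ψ.memLp.toLp (chart Ψ.fn)
  map_add' Ψ Φ := MemLp.toLp_add Ψ.memLp Φ.memLp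
  map_smul' c Ψ := MemLp.toLp_const_smul c Ψ.memLp
  norm_map' Ψ := norm_toLp_eq Ψ

lemma toLp_apply {d : ℕ} {J : ℂ} (Ψ : PreHilbertSection d J) :
    toLp d J Ψ = Ψ.memLp.toLp (chart Ψ.fn) := rfl

lemma isHomogeneous_ofChart {d : ℕ} (J : ℂ) (ψ : (Fin d → ℂ) → ℂ) :
    IsHomogeneous J (ofChart J ψ) := by
  refine ⟨by simp [ofChart], fun ρ x hρ => ?_⟩
  by_cases hx : x (Fin.last d) = 0
  · simp [ofChart, hx]
  · have h2 : ((‖ρ‖ : ℂ) * (‖x (Fin.last d)‖ : ℂ)) ^ (2 * J)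
        = (‖ρ‖ : ℂ) ^ (2 * J) * (‖x (Fin.last d)‖ : ℂ) ^ (2 * J) :=
      Complex.mul_cpow_ofReal_nonneg (norm_nonneg _) (norm_nonneg _) _
    simp [ofChart, hx, hρ, h2, mul_div_mul_left, mul_assoc]

lemma chart_ofChart {d : ℕ} (J : ℂ) (ψ : (Fin d → ℂ) → ℂ) : chart (ofChart J ψ) = ψ := by
  ext z
  simp [chart, ofChart]

lemma toLp_surjective (d : ℕ) (J : ℂ) : Function.Surjective (toLp d J) := fun f =>
  ⟨.mk ⟨ofChart J f, isHomogeneous_ofChart J f, by rw [chart_ofChart]; exact Lp.memLp f⟩, by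
    simp only [toLp_apply, PreHilbertSection.fn_mk, chart_ofChart]
    exact Lp.toLp_coeFn f _⟩

instance (d : ℕ) (J : ℂ) : CompleteSpace (PreHilbertSection d J) :=
  ((toLp d J).isometry.isUniformInducing.completeSpace_congr (toLp_surjective d J)).2 inferInstance

/-- On the critical line a smooth section is square-integrable. -/
lemma smooth_le_squareIntegrable {d : ℕ} {J : ℂ} (hJ : J.re = -((d : ℝ) + 1) / 2) :
    SmoothSection d J ≤ SquareIntegrable d J := by
  rintro Ψ ⟨hh, hs⟩
  refine ⟨hh, ?_⟩
  have hsn : ∀ z : Fin d → ℂ, (Fin.snoc z 1 : Fin (d + 1) → ℂ) ≠ 0 := fun z h => by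
    simpa using congrFun h (Fin.last d)
  have hc : Continuous (chart Ψ) := by
    refine hs.continuousOn.comp_continuous (f := fun z => (Fin.snoc z 1 : Fin (d + 1) → ℂ)) ?_ hsn
    refine continuous_pi fun i => ?_
    refine Fin.lastCases ?_ (fun j => ?_) i
    · simpa using continuous_const
    · simpa using continuous_apply j
  obtain ⟨C, hC⟩ := (isCompact_sphere (0 : Fin (d + 1) → ℂ) 1).exists_bound_of_continuousOn
    (hs.continuousOn.mono fun x hx h => by simp_all)
  have hb : ∀ z, ‖chart Ψ z‖ ^ 2 ≤
      (C ^ 2 * 2 ^ (2 * ((d : ℝ) + 1))) * (1 + ‖z‖) ^ (-(2 * ((d : ℝ) + 1))) := fun z => by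
    set x : Fin (d + 1) → ℂ := Fin.snoc z 1 with hx
    have hx1 : 1 ≤ ‖x‖ := by
      have := norm_le_pi_norm x (Fin.last d)
      simpa [hx] using this
    have hxz : ‖z‖ ≤ ‖x‖ := (pi_norm_le_iff_of_nonneg (norm_nonneg _)).2 fun i => by
      have := norm_le_pi_norm x i.castSucc
      simpa [hx] using this
    have hx0 : (0 : ℝ) < ‖x‖ := by linarith
    have hr : ((‖x‖ : ℝ) : ℂ) ≠ 0 := by exact_mod_cast hx0.ne'
    have hu : ‖(((‖x‖ : ℝ) : ℂ)⁻¹) • x‖ = 1 := by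
      rw [norm_smul]; simp [hx0.ne']
    have he := hh.2 (‖x‖ : ℂ) ((((‖x‖ : ℝ) : ℂ)⁻¹) • x) hr
    rw [smul_inv_smul₀ hr] at he
    have hB := hC _ (show (((‖x‖ : ℝ) : ℂ)⁻¹) • x ∈ Metric.sphere 0 1 by simpa using hu)
    have hn : ‖((‖((‖x‖ : ℝ) : ℂ)‖ : ℝ) : ℂ) ^ (2 * J)‖ = ‖x‖ ^ (-((d : ℝ) + 1)) := by
      rw [Complex.norm_real, norm_norm, Complex.norm_cpow_eq_rpow_re_of_pos hx0]
      congr 1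
      simp [hJ]
      ring
    have h1 : ‖chart Ψ z‖ ≤ ‖x‖ ^ (-((d : ℝ) + 1)) * C := by
      change ‖Ψ x‖ ≤ _
      rw [he, norm_mul, hn]
      gcongr
    have h2 : ‖x‖ ^ (-((d : ℝ) + 1)) ≤ ((1 + ‖z‖) / 2) ^ (-((d : ℝ) + 1)) :=
      Real.rpow_le_rpow_of_nonpos (by positivity) (by linarith) (by linarith [d.cast_nonneg (α := ℝ)])
    have hC0 : 0 ≤ C := (norm_nonneg _).trans hB
    calc ‖chart Ψ z‖ ^ 2 ≤ (((1 + ‖z‖) / 2) ^ (-((d : ℝ) + 1)) * C) ^ 2 := by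
          gcongr
          exact h1.trans (by gcongr)
      _ = _ := by
          have hp : (0 : ℝ) < 1 + ‖z‖ := by positivity
          rw [Real.div_rpow hp.le (by norm_num), mul_pow, div_pow, ← Real.rpow_mul_natCast hp.le,
            ← Real.rpow_mul_natCast (by norm_num : (0 : ℝ) ≤ 2), div_eq_mul_inv,
            ← Real.rpow_neg (by norm_num : (0 : ℝ) ≤ 2)]
          push_cast
          ring_nf
  rw [memLp_two_iff_integrable_sq_norm hc.aestronglyMeasurable]
  refine Integrable.mono' ((integrable_one_add_norm (μ := (volume : Measure (Fin d → ℂ)))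
    (r := 2 * ((d : ℝ) + 1)) ?_).const_mul (C ^ 2 * 2 ^ (2 * ((d : ℝ) + 1)))) ?_ ?_
  · rw [Module.finrank_pi_fintype]
    simp [Complex.finrank_real_complex]
    linarith [d.cast_nonneg (α := ℝ)]
  · exact (hc.norm.pow 2).aestronglyMeasurable
  · refine .of_forall fun z => ?_
    simpa using hb z

/-- The element of the Hilbert space given by a smooth section. -/
def toHilbert {d : ℕ} {J : ℂ} (hJ : J.re = -((d : ℝ) + 1) / 2) :
    SmoothSection d J →ₗ[ℂ] HilbertSection d J where
  toFun Ψ := SeparationQuotient.mk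
    (PreHilbertSection.mk ⟨Ψ.1, smooth_le_squareIntegrable hJ Ψ.2⟩)
  map_add' _ _ := rfl
  map_smul' _ _ := rfl

/-- The dual degree `-J - d - 1`. -/
def dualDegree (d : ℕ) (J : ℂ) : ℂ := -J - d - 1

lemma dualDegree_re {d : ℕ} {J : ℂ} (hJ : J.re = -((d : ℝ) + 1) / 2) :
    (dualDegree d J).re = -((d : ℝ) + 1) / 2 := by
  simp [dualDegree, hJ]
  ring

/-- The Fourier transform of a test function on `ℂ^{d+1}`,
`∫ f(k) ∏ᵣ exp(-2 i Im(kᵣ xᵣ)) d^{2(d+1)}k`, with `d²k = (Lebesgue measure)/π` for each variable. -/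
def testFourier {d : ℕ} (f : 𝓢(Fin (d + 1) → ℂ, ℂ)) (x : Fin (d + 1) → ℂ) : ℂ :=
  ((Real.pi : ℂ) ^ (d + 1))⁻¹ *
    ∫ k : Fin (d + 1) → ℂ, f k * ∏ r, Complex.exp (-2 * Complex.I * ((k r * x r).im : ℂ))

/-- `Φ` is the distributional Fourier transform of `Ψ`: both functions define regular
distributions on the Schwartz space and `⟨D_Φ, f⟩ = ⟨D_Ψ, f̂⟩` for all test functions. -/
def IsFourierTransform {d : ℕ} (Ψ Φ : (Fin (d + 1) → ℂ) → ℂ) : Prop :=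
  (∀ f : 𝓢(Fin (d + 1) → ℂ, ℂ), Integrable (fun x => Ψ x * f x) volume) ∧
  (∀ f : 𝓢(Fin (d + 1) → ℂ, ℂ), Integrable (fun k => Φ k * f k) volume) ∧
  ∀ f : 𝓢(Fin (d + 1) → ℂ, ℂ), ∫ k, Φ k * f k = ∫ x, Ψ x * testFourier f x

end ProjectiveFourier

end

open MeasureTheory Set Filter Topology
open scoped SchwartzMap ContDiff ComplexConjugate

noncomputable section

namespace ProjectiveFourier

/-! A homogeneous function is an average of a test function over complex dilations: the Mellin
transform `M_J g (x) = ∫ g(w x) |w|^{-2J-2} d²w` of a Schwartz function `g` is a smooth section of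
degree `J`, and every smooth section arises in this way, from a normalised radial cutoff of itself
(`exists_mellinTransform_eq`). The Fourier transform of `M_J g` is then `M_J̄ ĝ`, where `J̄ =
-J-d-1`.

Two facts prove this. In the chart, the integral of a section `Ψ` of degree `J` against a test
function `h` is the integral of the chart of `Ψ` times the chart of `M_J̄ h`
(`integral_mul_eq_integral_chart`), so that `∫ (M_J g) h = ∫ g (M_J̄ h)`. Moreover the
multiplication formula `∫ ĝ(w k) f(k) dk = ∫ g(x) f̂(w x) dx` holds for every dilation `w`.
Integrating it against the kernel of degree `J̄` gives `∫ (M_J̄ ĝ) f = ∫ g (M_J̄ f̂) = ∫ (M_J g)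
f̂`.

The norm identity comes from the test function `f = conj ĝ`, whose transform is `conj g`. On the
critical line conjugation maps sections of degree `J` to sections of degree `J̄`, and after
conjugation the chart formula turns the two sides of the defining identity into the two squared
norms.

Sections are determined by their distributions (`SmoothSection.eq_of_integral_mul_eq`), which gives
uniqueness and linearity. Fourier inversion produces `f(-x)`, and sections are even, so the relation
is symmetric and the map bijective. Smooth sections are dense because they contain the smooth
compactly supported functions of the chart, and the isometry extends. -/

/-! ### Radial integrability and complex dilations. -/

/-- In polar coordinates the integrand is dominated by the power `b` on `(0, 1]` and by the power `b
+ c` on `(1, ∞)`. The two hypotheses together force `c ≤ 0`, which both bounds need. -/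
lemma integrable_norm_rpow_mul_one_add_norm_rpow {E : Type*} [NormedAddCommGroup E]
    [NormedSpace ℝ E] [FiniteDimensional ℝ E] [Nontrivial E] [MeasurableSpace E] [BorelSpace E]
    (μ : Measure E) [μ.IsAddHaarMeasure] {b c : ℝ} (hb : -(Module.finrank ℝ E : ℝ) < b)
    (hc : b + c < -(Module.finrank ℝ E : ℝ)) :
    Integrable (fun x : E => ‖x‖ ^ b * (1 + ‖x‖) ^ c) μ := by
  rw [integrable_fun_norm_addHaar μ (f := fun y : ℝ => y ^ b * (1 + y) ^ c)]
  have hN : 1 ≤ Module.finrank ℝ E := Module.finrank_pos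
  have hc0 : c ≤ 0 := by linarith
  have hcont : ContinuousOn
      (fun y : ℝ => y ^ (Module.finrank ℝ E - 1) • (y ^ b * (1 + y) ^ c)) (Ioi 0) := by
    intro y (hy : 0 < y)
    refine ContinuousAt.continuousWithinAt ?_
    refine (continuousAt_id.pow _).smul ((Real.continuousAt_rpow_const _ _ (.inl hy.ne')).mul ?_)
    exact (continuousAt_const.add continuousAt_id).rpow_const (.inl (by simp; positivity))
  have hpow : ∀ y : ℝ, 0 < y → ∀ s : ℝ,
      y ^ (Module.finrank ℝ E - 1) * y ^ s = y ^ ((Module.finrank ℝ E : ℝ) - 1 + s) := by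
    intro y hy s
    rw [Real.rpow_add hy, ← Real.rpow_natCast, Nat.cast_sub hN, Nat.cast_one]
  rw [← Ioc_union_Ioi_eq_Ioi (zero_le_one (α := ℝ)), integrableOn_union]
  constructor
  · have hi : IntegrableOn (fun y : ℝ => y ^ ((Module.finrank ℝ E : ℝ) - 1 + b)) (Ioc 0 1) := by
      rw [← intervalIntegrable_iff_integrableOn_Ioc_of_le zero_le_one]
      exact intervalIntegral.intervalIntegrable_rpow' (by linarith)
    refine Integrable.mono' hi ((hcont.mono Ioc_subset_Ioi_self).aestronglyMeasurable
      measurableSet_Ioc) ?_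
    refine (ae_restrict_iff' measurableSet_Ioc).2 (.of_forall fun y hy => ?_)
    have hy0 : 0 < y := hy.1
    rw [Real.norm_of_nonneg (by positivity), smul_eq_mul, ← hpow y hy0]
    gcongr
    exact mul_le_of_le_one_right (by positivity)
      (Real.rpow_le_one_of_one_le_of_nonpos (by linarith) hc0)
  · have hi : IntegrableOn (fun y : ℝ => y ^ ((Module.finrank ℝ E : ℝ) - 1 + (b + c))) (Ioi 1) :=
      integrableOn_Ioi_rpow_of_lt (by linarith) one_pos
    refine Integrable.mono' hi ((hcont.mono (Ioi_subset_Ioi zero_le_one)).aestronglyMeasurable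
      measurableSet_Ioi) ?_
    refine (ae_restrict_iff' measurableSet_Ioi).2 (.of_forall fun y (hy : 1 < y) => ?_)
    have hy0 : 0 < y := by linarith
    rw [Real.norm_of_nonneg (by positivity), smul_eq_mul, ← hpow y hy0, Real.rpow_add hy0]
    gcongr ?_ * (?_ * ?_)
    exact Real.rpow_le_rpow_of_nonpos hy0 (by linarith) hc0

lemma exists_norm_le_one_add_norm_rpow {E F : Type*} [NormedAddCommGroup E] [NormedSpace ℝ E]
    [NormedAddCommGroup F] [NormedSpace ℝ F] (h : 𝓢(E, F)) (k : ℕ) :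
    ∃ C : ℝ, 0 ≤ C ∧ ∀ x, ‖h x‖ ≤ C * (1 + ‖x‖) ^ (-(k : ℝ)) := by
  refine ⟨2 ^ k * ((Finset.Iic (k, 0)).sup fun m => SchwartzMap.seminorm ℝ m.1 m.2) h,
    by positivity, fun x => ?_⟩
  have := SchwartzMap.one_add_le_sup_seminorm_apply (𝕜 := ℝ) (m := (k, 0)) le_rfl le_rfl h x
  rw [norm_iteratedFDeriv_zero] at this
  have h1 : 0 < 1 + ‖x‖ := by positivity
  rw [Real.rpow_neg h1.le, Real.rpow_natCast, ← div_eq_mul_inv, le_div_iff₀ (by positivity)]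
  simpa [mul_comm] using this

lemma measurePreserving_circle_smul (u : Circle) :
    MeasurePreserving (fun z : ℂ => (u : ℂ) • z) volume volume :=
  (rotation u).measurePreserving

lemma exists_eq_norm_mul_circle (c : ℂ) : ∃ u : Circle, c = (‖c‖ : ℂ) * u := by
  exact ⟨Circle.exp c.arg, by rw [Circle.coe_exp, Complex.norm_mul_exp_arg_mul_I]⟩

/-- Multiplication by `c` is a rotation of each coordinate, which preserves volume, followed by the
real dilation by `‖c‖` in real dimension `2 * card ι`. -/
lemma integral_comp_complex_smul {ι F : Type*} [Fintype ι] [NormedAddCommGroup F]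
    [NormedSpace ℝ F] {c : ℂ} (hc : c ≠ 0) (f : (ι → ℂ) → F) :
    ∫ z, f (c • z) = (‖c‖ ^ (2 * Fintype.card ι))⁻¹ • ∫ z, f z := by
  obtain ⟨u, hu⟩ := exists_eq_norm_mul_circle c
  have hm : MeasurePreserving (fun z : ι → ℂ => fun i => (u : ℂ) • z i) volume volume :=
    volume_preserving_pi fun _ => measurePreserving_circle_smul u
  have he : MeasurableEmbedding (fun z : ι → ℂ => fun i => (u : ℂ) • z i) :=
    (Homeomorph.smulOfNeZero (u : ℂ) u.coe_ne_zero).measurableEmbedding (γ := ι → ℂ)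
  have h1 := hm.integral_comp he (fun z => f (‖c‖ • z))
  have h2 := Measure.integral_comp_smul (volume : Measure (ι → ℂ)) f ‖c‖
  rw [h2, Module.finrank_pi_fintype] at h1
  simp only [Complex.finrank_real_complex, Finset.sum_const, Finset.card_univ, smul_eq_mul,
    mul_comm _ 2] at h1
  rw [abs_of_nonneg (by positivity)] at h1
  rw [← h1]
  congr 1 with z
  congr 1
  ext i
  simp only [Pi.smul_apply, Complex.real_smul, smul_eq_mul]
  conv_lhs => rw [hu]
  ring

lemma integral_comp_complex_mul {F : Type*} [NormedAddCommGroup F]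
    [NormedSpace ℝ F] {c : ℂ} (hc : c ≠ 0) (f : ℂ → F) :
    ∫ z, f (c * z) = (‖c‖ ^ 2)⁻¹ • ∫ z, f z := by
  have hm := volume_preserving_funUnique (Unit) ℂ
  have h1 := integral_comp_complex_smul (ι := Unit) hc (fun z => f (z default))
  have h2 := hm.integral_comp (MeasurableEquiv.measurableEmbedding _) (fun z => f z)
  have h3 := hm.integral_comp (MeasurableEquiv.measurableEmbedding _) (fun z => f (c * z))
  rw [← h2, ← h3]
  simpa using h1

/-! ### The complex Mellin transform. -/

/-- The weight `|w|^{-2J-2}` of the complex Mellin transform. -/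
def mellinKernel (J w : ℂ) : ℂ := (‖w‖ : ℂ) ^ (-2 * J - 2)

/-- The complex Mellin transform `∫ h(w x) |w|^{-2J-2} d²w`, set to zero at the origin. -/
def mellinTransform {d : ℕ} (J : ℂ) (h : (Fin (d + 1) → ℂ) → ℂ) (x : Fin (d + 1) → ℂ) : ℂ :=
  if x = 0 then 0 else ∫ w : ℂ, mellinKernel J w * h (w • x)

lemma measurable_mellinKernel (J : ℂ) : Measurable (mellinKernel J) := by
  unfold mellinKernel
  fun_prop

lemma continuousOn_mellinKernel (J : ℂ) : ContinuousOn (mellinKernel J) {0}ᶜ := by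
  intro w hw
  refine ContinuousAt.continuousWithinAt ?_
  refine ContinuousAt.cpow (by fun_prop) continuousAt_const ?_
  exact Complex.ofReal_mem_slitPlane.2 (norm_pos_iff.2 hw)

lemma norm_mellinKernel {J w : ℂ} (hw : w ≠ 0) : ‖mellinKernel J w‖ = ‖w‖ ^ (-2 * J.re - 2) := by
  rw [mellinKernel, Complex.norm_cpow_eq_rpow_re_of_pos (norm_pos_iff.2 hw)]
  simp

lemma mellinKernel_mul (J v w : ℂ) :
    mellinKernel J (v * w) = mellinKernel J v * mellinKernel J w := by
  simp only [mellinKernel, norm_mul, Complex.ofReal_mul]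
  exact Complex.mul_cpow_ofReal_nonneg (norm_nonneg _) (norm_nonneg _) _

lemma mellinKernel_inv {J w : ℂ} (hw : w ≠ 0) :
    mellinKernel J w⁻¹ = ((‖w‖ : ℂ) ^ (2 * J)) * (‖w‖ : ℂ) ^ 2 := by
  have h : (‖w‖ : ℂ) ≠ 0 := by simpa using hw
  rw [mellinKernel, norm_inv, Complex.ofReal_inv, Complex.inv_cpow _ _ (by
    rw [Complex.arg_ofReal_of_nonneg (norm_nonneg _)]; exact Real.pi_pos.ne),
    ← Complex.cpow_neg, ← Complex.cpow_natCast, ← Complex.cpow_add _ _ h]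
  congr 1
  push_cast
  ring

/-- Substituting `v = ρ w`, the kernel contributes `|ρ|^{2J+2}` and the Jacobian `|ρ|^{-2}`. The
substitution rule needs no integrability, so `h` is arbitrary. -/
lemma isHomogeneous_mellinTransform {d : ℕ} (J : ℂ) (h : (Fin (d + 1) → ℂ) → ℂ) :
    IsHomogeneous J (mellinTransform J h) := by
  refine ⟨by simp [mellinTransform], fun ρ x hρ => ?_⟩
  by_cases hx : x = 0
  · simp [mellinTransform, hx]
  simp only [mellinTransform, smul_eq_zero, hρ, hx, or_self, if_false]
  have h1 := integral_comp_complex_mul hρ (fun v => mellinKernel J (ρ⁻¹ * v) * h (v • x))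
  simp only [inv_mul_cancel_left₀ hρ, mellinKernel_mul, mellinKernel_inv hρ, mul_assoc,
    integral_const_mul] at h1
  simp only [smul_smul, mul_comm _ ρ]
  rw [h1, Complex.real_smul]
  have h : (‖ρ‖ : ℂ) ≠ 0 := by simpa using hρ
  push_cast
  field_simp

lemma integrable_rpow_mul_one_add_rpow_mul {a r : ℝ} {k : ℕ} (hr : 0 < r) (ha : -2 < a)
    (hk : a + 2 < k) : Integrable (fun w : ℂ => ‖w‖ ^ a * (1 + ‖w‖ * r) ^ (-(k : ℝ))) := by
  have h1 := integrable_norm_rpow_mul_one_add_norm_rpow (volume : Measure ℂ) (b := a)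
    (c := -(k : ℝ)) (by simpa [Complex.finrank_real_complex] using ha)
    (by simp [Complex.finrank_real_complex]; linarith)
  have h2 := (h1.comp_smul hr.ne').const_mul (r ^ (-a))
  refine h2.congr (.of_forall fun w => ?_)
  simp only [norm_smul, Real.norm_of_nonneg hr.le]
  rw [Real.mul_rpow hr.le (norm_nonneg _), ← mul_assoc, ← mul_assoc, ← Real.rpow_add hr]
  simp [mul_comm r]

/-- Rescaling `w` by `r`. For `a = -2 Re J - 2` and `r = ‖x‖` the power of `r` is `‖x‖^{2 Re J}`,
the size of a section of degree `J`. -/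
lemma integral_rpow_mul_one_add_rpow_mul {a r : ℝ} (k : ℕ) (hr : 0 < r) :
    ∫ w : ℂ, ‖w‖ ^ a * (1 + ‖w‖ * r) ^ (-(k : ℝ)) =
      r ^ (-a - 2) * ∫ w : ℂ, ‖w‖ ^ a * (1 + ‖w‖) ^ (-(k : ℝ)) := by
  have h2 := Measure.integral_comp_smul (volume : Measure ℂ)
    (fun w : ℂ => ‖w‖ ^ a * (1 + ‖w‖) ^ (-(k : ℝ))) r
  simp only [norm_smul, Real.norm_of_nonneg hr.le, Real.mul_rpow hr.le (norm_nonneg _), mul_assoc,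
    integral_const_mul, Complex.finrank_real_complex, smul_eq_mul, abs_inv, abs_pow,
    abs_of_pos hr] at h2
  have h3 : r ^ (-a - 2) = r ^ (-a) * (r ^ 2)⁻¹ := by
    rw [sub_eq_add_neg, Real.rpow_add hr, Real.rpow_neg hr.le 2]; norm_num
  rw [h3, mul_assoc, ← h2, ← mul_assoc, ← Real.rpow_add hr]
  simp [mul_comm r]

variable {d : ℕ}

lemma norm_mellin_integrand_le {J : ℂ} {h : (Fin (d + 1) → ℂ) → ℂ} {C : ℝ} {k : ℕ}
    (hC : ∀ x, ‖h x‖ ≤ C * (1 + ‖x‖) ^ (-(k : ℝ))) {w : ℂ} (hw : w ≠ 0) (x : Fin (d + 1) → ℂ) :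
    ‖mellinKernel J w * h (w • x)‖ ≤
      C * (‖w‖ ^ (-2 * J.re - 2) * (1 + ‖w‖ * ‖x‖) ^ (-(k : ℝ))) := by
  rw [norm_mul, norm_mellinKernel hw, mul_left_comm]
  gcongr
  simpa [norm_smul] using hC (w • x)

lemma integrable_mellin_integrand {J : ℂ} (hJ : J.re < 0) (h : 𝓢(Fin (d + 1) → ℂ, ℂ))
    {x : Fin (d + 1) → ℂ} (hx : x ≠ 0) :
    Integrable (fun w : ℂ => mellinKernel J w * h (w • x)) := by
  obtain ⟨k, hk⟩ := exists_nat_gt (-2 * J.re)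
  obtain ⟨C, -, hC⟩ := exists_norm_le_one_add_norm_rpow h k
  refine ((integrable_rpow_mul_one_add_rpow_mul (norm_pos_iff.2 hx) (a := -2 * J.re - 2) (k := k)
    (by linarith) (by linarith)).const_mul C).mono' ?_ ?_
  · exact ((measurable_mellinKernel J).mul
      (h.continuous.measurable.comp (by fun_prop))).aestronglyMeasurable
  · filter_upwards [compl_mem_ae_iff.2 (measure_singleton (0 : ℂ))] with w hw
    exact norm_mellin_integrand_le hC hw x

/-- By Tonelli: the inner integral of the norm is at most a constant times `‖A x‖ * ‖p x‖ ^ (2 *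
J.re)`. The abstract `p` serves two cases, the identity of `ℂ^{d+1}` and the chart `z ↦ (z, 1)`. -/
lemma integrable_prod_mellin {X : Type*} [MeasurableSpace X] {μ : Measure X} [SFinite μ]
    {J : ℂ} (hJ : J.re < 0) (h : 𝓢(Fin (d + 1) → ℂ, ℂ)) {A : X → ℂ} {p : X → Fin (d + 1) → ℂ}
    (hA : AEStronglyMeasurable A μ) (hp : Measurable p) (hp0 : ∀ᵐ x ∂μ, p x ≠ 0)
    (hi : Integrable (fun x => ‖A x‖ * ‖p x‖ ^ (2 * J.re)) μ) :
    Integrable (fun q : X × ℂ => A q.1 * (mellinKernel J q.2 * h (q.2 • p q.1)))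
      (μ.prod volume) := by
  obtain ⟨k, hk⟩ := exists_nat_gt (-2 * J.re)
  obtain ⟨C, hC0, hC⟩ := exists_norm_le_one_add_norm_rpow h k
  have hm : AEStronglyMeasurable
      (fun q : X × ℂ => A q.1 * (mellinKernel J q.2 * h (q.2 • p q.1))) (μ.prod volume) := by
    refine hA.comp_fst.mul (Measurable.aestronglyMeasurable ?_)
    exact ((measurable_mellinKernel J).comp measurable_snd).mul
      (h.continuous.measurable.comp (measurable_snd.smul (hp.comp measurable_fst)))
  rw [integrable_prod_iff hm]
  refine ⟨?_, ?_⟩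
  · filter_upwards [hp0] with x hx
    exact (integrable_mellin_integrand hJ h hx).const_mul _
  · set K := ∫ w : ℂ, ‖w‖ ^ (-2 * J.re - 2) * (1 + ‖w‖) ^ (-(k : ℝ))
    refine (hi.mul_const (C * K)).mono' hm.norm.integral_prod_right' ?_
    filter_upwards [hp0] with x hx
    have hx0 := norm_pos_iff.2 hx
    rw [Real.norm_of_nonneg (integral_nonneg fun _ => norm_nonneg _)]
    simp only [norm_mul (A x), integral_const_mul]
    rw [mul_assoc]
    gcongr
    have he : ‖p x‖ ^ (2 * J.re) * (C * K) =
        ∫ w : ℂ, C * (‖w‖ ^ (-2 * J.re - 2) * (1 + ‖w‖ * ‖p x‖) ^ (-(k : ℝ))) := by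
      rw [integral_const_mul, integral_rpow_mul_one_add_rpow_mul k hx0]
      have : -(-2 * J.re - 2) - 2 = 2 * J.re := by ring
      rw [this]; ring
    rw [he]
    refine integral_mono_ae (integrable_mellin_integrand hJ h hx).norm
      ((integrable_rpow_mul_one_add_rpow_mul hx0 (by linarith) (by linarith)).const_mul C) ?_
    filter_upwards [compl_mem_ae_iff.2 (measure_singleton (0 : ℂ))] with w hw
    exact norm_mellin_integrand_le hC hw (p x)

/-! ### Smoothness of the Mellin transform off the origin. -/

section Smooth

variable {E : Type} [NormedAddCommGroup E] [NormedSpace ℂ E]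
  {F G : Type} [NormedAddCommGroup F] [NormedSpace ℝ F] [NormedAddCommGroup G] [NormedSpace ℝ G]

/-- The operator `T ↦ L w ∘ T ∘ (w • ·)` that appears when an integrand `L w (h (w x))` is
differentiated in `x`. -/
def dilationDeriv (E : Type) [NormedAddCommGroup E] [NormedSpace ℂ E]
    (L : ℂ → F →L[ℝ] G) (w : ℂ) : (E →L[ℝ] F) →L[ℝ] (E →L[ℝ] G) :=
  (ContinuousLinearMap.compL ℝ E F G (L w)).comp
    ((ContinuousLinearMap.compL ℝ E E F).flip (ContinuousLinearMap.lsmul ℝ ℂ w))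

lemma dilationDeriv_apply (L : ℂ → F →L[ℝ] G) (w : ℂ) (T : E →L[ℝ] F) :
    dilationDeriv E L w T = (L w).comp (T.comp (ContinuousLinearMap.lsmul ℝ ℂ w)) := rfl

lemma continuousOn_dilationDeriv {L : ℂ → F →L[ℝ] G} (hL : ContinuousOn L {0}ᶜ) :
    ContinuousOn (dilationDeriv E L) {0}ᶜ := by
  have h1 : ContinuousOn (fun w => ContinuousLinearMap.compL ℝ E F G (L w)) {0}ᶜ :=
    (ContinuousLinearMap.continuous _).comp_continuousOn hL
  have h2 : Continuous (fun w : ℂ => (ContinuousLinearMap.compL ℝ E E F).flip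
      (ContinuousLinearMap.lsmul ℝ ℂ w)) :=
    (ContinuousLinearMap.continuous _).comp (ContinuousLinearMap.continuous _)
  exact h1.clm_comp h2.continuousOn

lemma norm_dilationDeriv_le {L : ℂ → F →L[ℝ] G} {w : ℂ} {C b : ℝ} (hw : w ≠ 0)
    (hL : ‖L w‖ ≤ C * ‖w‖ ^ b) : ‖dilationDeriv E L w‖ ≤ C * ‖w‖ ^ (b + 1) := by
  have hw' := norm_pos_iff.2 hw
  have h0 := (norm_nonneg _).trans hL
  refine ContinuousLinearMap.opNorm_le_bound _ ?_ fun T => ?_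
  · rw [Real.rpow_add hw', Real.rpow_one, ← mul_assoc]
    exact mul_nonneg h0 hw'.le
  · have h1 : ‖(ContinuousLinearMap.lsmul ℝ ℂ w : E →L[ℝ] E)‖ ≤ ‖w‖ :=
      ContinuousLinearMap.opNorm_lsmul_apply_le w
    rw [dilationDeriv_apply, Real.rpow_add hw', Real.rpow_one, ← mul_assoc]
    calc _ ≤ ‖L w‖ * (‖T‖ * ‖(ContinuousLinearMap.lsmul ℝ ℂ w : E →L[ℝ] E)‖) :=
          (ContinuousLinearMap.opNorm_comp_le _ _).trans
            (by gcongr; exact ContinuousLinearMap.opNorm_comp_le _ _)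
      _ ≤ (C * ‖w‖ ^ b) * (‖T‖ * ‖w‖) := by gcongr
      _ = _ := by ring

lemma aestronglyMeasurable_dilation {L : ℂ → F →L[ℝ] G} (hL : ContinuousOn L {0}ᶜ)
    (h : 𝓢(E, F)) (x : E) : AEStronglyMeasurable (fun w : ℂ => L w (h (w • x))) := by
  have hc : ContinuousOn (fun w : ℂ => L w (h (w • x))) {0}ᶜ :=
    hL.clm_apply (h.continuous.comp (continuous_id.smul continuous_const)).continuousOn
  have := hc.aestronglyMeasurable (μ := volume) (measurableSet_singleton 0).compl
  rwa [restrict_compl_singleton] at this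

/-- The bound depends on `x` only through the lower bound `r` of its norm, so it can dominate on a
whole neighbourhood. -/
lemma norm_dilation_le {L : ℂ → F →L[ℝ] G} {C b : ℝ} (hL : ∀ w ≠ 0, ‖L w‖ ≤ C * ‖w‖ ^ b)
    (hC : 0 ≤ C) {h : E → F} {D : ℝ} {k : ℕ} (hD : ∀ x, ‖h x‖ ≤ D * (1 + ‖x‖) ^ (-(k : ℝ)))
    (hD0 : 0 ≤ D) {w : ℂ} (hw : w ≠ 0) {x : E} {r : ℝ} (hr : 0 < r) (hx : r ≤ ‖x‖) :
    ‖L w (h (w • x))‖ ≤ C * D * (‖w‖ ^ b * (1 + ‖w‖ * r) ^ (-(k : ℝ))) := by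
  calc _ ≤ ‖L w‖ * ‖h (w • x)‖ := (L w).le_opNorm _
    _ ≤ (C * ‖w‖ ^ b) * (D * (1 + ‖w • x‖) ^ (-(k : ℝ))) := by
      gcongr
      · exact hL w hw
      · exact hD _
    _ ≤ (C * ‖w‖ ^ b) * (D * (1 + ‖w‖ * r) ^ (-(k : ℝ))) := by
      gcongr ?_ * (_ * ?_)
      refine Real.rpow_le_rpow_of_nonpos (by positivity) ?_ (by simp)
      rw [norm_smul]
      gcongr
    _ = _ := by ring

lemma integrable_dilation {L : ℂ → F →L[ℝ] G} (hLc : ContinuousOn L {0}ᶜ) {C b : ℝ}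
    (hL : ∀ w ≠ 0, ‖L w‖ ≤ C * ‖w‖ ^ b) (hC : 0 ≤ C) (hb : -2 < b) (h : 𝓢(E, F)) {x : E}
    (hx : x ≠ 0) : Integrable (fun w : ℂ => L w (h (w • x))) := by
  obtain ⟨k, hk⟩ := exists_nat_gt (b + 2)
  obtain ⟨D, hD0, hD⟩ := exists_norm_le_one_add_norm_rpow h k
  have hx0 := norm_pos_iff.2 hx
  refine ((integrable_rpow_mul_one_add_rpow_mul hx0 hb hk).const_mul (C * D)).mono'
    (aestronglyMeasurable_dilation hLc h x) ?_
  filter_upwards [compl_mem_ae_iff.2 (measure_singleton (0 : ℂ))] with w hw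
  exact norm_dilation_le hL hC hD hD0 hw hx0 le_rfl

/-- Differentiation under the integral sign, dominated on the ball of radius `‖x₀‖ / 2`, where `‖x‖
≥ ‖x₀‖ / 2`. The derivative is again an integral of the same shape. -/
lemma hasFDerivAt_integral_dilation {L : ℂ → F →L[ℝ] G} (hLc : ContinuousOn L {0}ᶜ) {C b : ℝ}
    (hL : ∀ w ≠ 0, ‖L w‖ ≤ C * ‖w‖ ^ b) (hC : 0 ≤ C) (hb : -2 < b) (h : 𝓢(E, F)) {x₀ : E}
    (hx : x₀ ≠ 0) : HasFDerivAt (fun x => ∫ w : ℂ, L w (h (w • x)))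
      (∫ w : ℂ, dilationDeriv E L w (SchwartzMap.fderivCLM ℝ E F h (w • x₀))) x₀ := by
  obtain ⟨k, hk⟩ := exists_nat_gt (b + 1 + 2)
  obtain ⟨D, hD0, hD⟩ := exists_norm_le_one_add_norm_rpow (SchwartzMap.fderivCLM ℝ E F h) k
  have hx0 : 0 < ‖x₀‖ / 2 := half_pos (norm_pos_iff.2 hx)
  refine hasFDerivAt_integral_of_dominated_of_fderiv_le (𝕜 := ℝ)
    (bound := fun w : ℂ => C * D * (‖w‖ ^ (b + 1) * (1 + ‖w‖ * (‖x₀‖ / 2)) ^ (-(k : ℝ))))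
    (F' := fun x w => dilationDeriv E L w (SchwartzMap.fderivCLM ℝ E F h (w • x)))
    (Metric.ball_mem_nhds x₀ hx0) (.of_forall fun x => aestronglyMeasurable_dilation hLc h x)
    (integrable_dilation hLc hL hC hb h hx)
    (aestronglyMeasurable_dilation (continuousOn_dilationDeriv hLc) _ _) ?_
    ((integrable_rpow_mul_one_add_rpow_mul hx0 (by linarith) hk).const_mul (C * D)) ?_
  · filter_upwards [compl_mem_ae_iff.2 (measure_singleton (0 : ℂ))] with w hw x hx
    refine norm_dilation_le (fun w hw => norm_dilationDeriv_le hw (hL w hw)) hC hD hD0 hw hx0 ?_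
    have h1 : ‖x₀‖ ≤ ‖x‖ + ‖x - x₀‖ := by
      have := norm_sub_le x (x - x₀); simpa using this
    have h2 : ‖x - x₀‖ < ‖x₀‖ / 2 := by simpa [dist_eq_norm] using hx
    linarith
  · refine .of_forall fun w x _ => ?_
    rw [dilationDeriv_apply, SchwartzMap.fderivCLM_apply]
    exact (L w).hasFDerivAt.comp x ((h.differentiableAt.hasFDerivAt (x := w • x)).comp x
      (ContinuousLinearMap.lsmul ℝ ℂ w : E →L[ℝ] E).hasFDerivAt)

end Smooth

/-- Each derivative replaces `h` by its Fréchet derivative, `L` by `dilationDeriv E L` and `b` by `b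
+ 1`, which keeps `-2 < b`. The spaces `F` and `G` change as well, so they are quantified inside the
induction. -/
lemma contDiffOn_nat_integral_dilation {E : Type} [NormedAddCommGroup E] [NormedSpace ℂ E] (n : ℕ) :
    ∀ {F G : Type} [NormedAddCommGroup F] [NormedSpace ℝ F] [NormedAddCommGroup G]
      [NormedSpace ℝ G] {L : ℂ → F →L[ℝ] G} (_ : ContinuousOn L {0}ᶜ) {C b : ℝ}
      (_ : ∀ w ≠ 0, ‖L w‖ ≤ C * ‖w‖ ^ b) (_ : 0 ≤ C) (_ : -2 < b) (h : 𝓢(E, F)),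
      ContDiffOn ℝ n (fun x => ∫ w : ℂ, L w (h (w • x))) {0}ᶜ := by
  induction n with
  | zero =>
    intro F G _ _ _ _ L hLc C b hL hC hb h
    refine contDiffOn_zero.2 fun x hx => ?_
    exact (hasFDerivAt_integral_dilation hLc hL hC hb h hx).continuousAt.continuousWithinAt
  | succ n ih =>
    intro F G _ _ _ _ L hLc C b hL hC hb h
    have hd := fun x (hx : x ∈ ({0}ᶜ : Set E)) => hasFDerivAt_integral_dilation hLc hL hC hb h hx
    rw [Nat.cast_add, Nat.cast_one, contDiffOn_succ_iff_fderiv_of_isOpen isOpen_compl_singleton]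
    refine ⟨fun x hx => (hd x hx).differentiableAt.differentiableWithinAt, by simp, ?_⟩
    refine (ih (continuousOn_dilationDeriv hLc)
      (fun w hw => norm_dilationDeriv_le hw (hL w hw)) hC (by linarith)
      (SchwartzMap.fderivCLM ℝ E F h)).congr fun x hx => (hd x hx).fderiv

lemma contDiffOn_mellinTransform {J : ℂ} (hJ : J.re < 0)
    (h : 𝓢(Fin (d + 1) → ℂ, ℂ)) : ContDiffOn ℝ ∞ (mellinTransform J h) {0}ᶜ := by
  refine contDiffOn_infty.2 fun n => ?_
  refine (contDiffOn_nat_integral_dilation (E := Fin (d + 1) → ℂ) n (F := ℂ) (G := ℂ)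
    (L := fun w => ContinuousLinearMap.mul ℝ ℂ (mellinKernel J w)) (C := 1) (b := -2 * J.re - 2)
    ?_ ?_ zero_le_one (by linarith) h).congr ?_
  · exact (ContinuousLinearMap.continuous _).comp_continuousOn (continuousOn_mellinKernel J)
  · intro w hw
    rw [one_mul, ← norm_mellinKernel hw]
    exact ContinuousLinearMap.opNorm_mul_apply_le ℝ ℂ _
  · intro x hx
    simp [mellinTransform, show x ≠ 0 from hx]

lemma mellinTransform_mem {J : ℂ} (hJ : J.re < 0) (h : 𝓢(Fin (d + 1) → ℂ, ℂ)) :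
    mellinTransform J h ∈ SmoothSection d J :=
  ⟨isHomogeneous_mellinTransform J h, contDiffOn_mellinTransform hJ h⟩

/-! ### Sections as distributions and the pairing in the chart. -/

lemma integral_mul_mellinTransform {X : Type*} [MeasurableSpace X] {μ : Measure X} [SFinite μ]
    {J : ℂ} (hJ : J.re < 0) (h : 𝓢(Fin (d + 1) → ℂ, ℂ)) {A : X → ℂ} {p : X → Fin (d + 1) → ℂ}
    (hA : AEStronglyMeasurable A μ) (hp : Measurable p) (hp0 : ∀ᵐ x ∂μ, p x ≠ 0)
    (hi : Integrable (fun x => ‖A x‖ * ‖p x‖ ^ (2 * J.re)) μ) :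
    ∫ x, A x * mellinTransform J h (p x) ∂μ =
      ∫ w, mellinKernel J w * ∫ x, A x * h (w • p x) ∂μ := by
  have h1 := integral_integral_swap
    (f := fun x w => A x * (mellinKernel J w * h (w • p x)))
    (integrable_prod_mellin hJ h hA hp hp0 hi)
  have h2 : ∫ x, A x * mellinTransform J h (p x) ∂μ =
      ∫ x, (∫ w : ℂ, A x * (mellinKernel J w * h (w • p x))) ∂μ := by
    refine integral_congr_ae ?_
    filter_upwards [hp0] with x hx
    rw [integral_const_mul, mellinTransform, if_neg hx]
  rw [h2, h1]
  simp only [mul_left_comm _ (mellinKernel _ _), integral_const_mul]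

lemma re_neg_of_critical {J : ℂ} (hJ : J.re = -((d : ℝ) + 1) / 2) : J.re < 0 := by
  rw [hJ]
  have : (0 : ℝ) ≤ d := d.cast_nonneg
  linarith

lemma IsHomogeneous.exists_norm_le {J : ℂ} (hJ : J.re = -((d : ℝ) + 1) / 2)
    {Ψ : (Fin (d + 1) → ℂ) → ℂ} (hh : IsHomogeneous J Ψ) (hc : ContinuousOn Ψ {0}ᶜ) :
    ∃ C : ℝ, 0 ≤ C ∧ ∀ x, ‖Ψ x‖ ≤ C * ‖x‖ ^ (-((d : ℝ) + 1)) := by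
  obtain ⟨C, hC⟩ := (isCompact_sphere (0 : Fin (d + 1) → ℂ) 1).exists_bound_of_continuousOn
    (hc.mono fun x hx h => by simp_all)
  refine ⟨max C 0, le_max_right _ _, fun x => ?_⟩
  by_cases hx : x = 0
  · simp only [hx, hh.1, norm_zero]
    positivity
  have hx0 := norm_pos_iff.2 hx
  have hr : ((‖x‖ : ℝ) : ℂ) ≠ 0 := by exact_mod_cast hx0.ne'
  have hu : ‖(((‖x‖ : ℝ) : ℂ)⁻¹) • x‖ = 1 := by
    rw [norm_smul]; simp [hx0.ne']
  have he := hh.2 (‖x‖ : ℂ) ((((‖x‖ : ℝ) : ℂ)⁻¹) • x) hr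
  rw [smul_inv_smul₀ hr] at he
  have hB := hC _ (show (((‖x‖ : ℝ) : ℂ)⁻¹) • x ∈ Metric.sphere 0 1 by simpa using hu)
  have hn : ‖((‖((‖x‖ : ℝ) : ℂ)‖ : ℝ) : ℂ) ^ (2 * J)‖ = ‖x‖ ^ (-((d : ℝ) + 1)) := by
    rw [Complex.norm_real, norm_norm, Complex.norm_cpow_eq_rpow_re_of_pos hx0]
    congr 1
    simp [hJ]
    ring
  rw [he, norm_mul, hn, mul_comm]
  gcongr
  exact hB.trans (le_max_left _ _)

lemma aestronglyMeasurable_of_continuousOn_compl {Ψ : (Fin (d + 1) → ℂ) → ℂ}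
    (hc : ContinuousOn Ψ {0}ᶜ) : AEStronglyMeasurable Ψ volume := by
  have := hc.aestronglyMeasurable (μ := volume) (measurableSet_singleton 0).compl
  rwa [restrict_compl_singleton] at this

lemma finrank_complex_pi (m : ℕ) : Module.finrank ℝ (Fin m → ℂ) = 2 * m := by
  rw [Module.finrank_pi_fintype]
  simp [Complex.finrank_real_complex, mul_comm]

/-- The singularity has order `d + 1`, less than the real dimension `2 * d + 2`; this is why
sections on the critical line define regular distributions. -/
lemma integrable_schwartz_mul_norm_rpow (f : 𝓢(Fin (d + 1) → ℂ, ℂ)) :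
    Integrable (fun x => ‖f x‖ * ‖x‖ ^ (-((d : ℝ) + 1))) := by
  obtain ⟨C, hC0, hC⟩ := exists_norm_le_one_add_norm_rpow f (2 * d + 2)
  have hd : (0 : ℝ) ≤ d := d.cast_nonneg
  refine ((integrable_norm_rpow_mul_one_add_norm_rpow (volume : Measure (Fin (d + 1) → ℂ))
    (b := -((d : ℝ) + 1)) (c := -((2 * d + 2 : ℕ) : ℝ)) ?_ ?_).const_mul C).mono' ?_ ?_
  · rw [finrank_complex_pi]; push_cast; linarith
  · rw [finrank_complex_pi]; push_cast; linarith
  · exact (f.continuous.norm.measurable.mul (by fun_prop)).aestronglyMeasurable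
  · refine .of_forall fun x => ?_
    rw [Real.norm_of_nonneg (by positivity), mul_comm (‖x‖ ^ _), ← mul_assoc]
    gcongr
    exact hC x

lemma SmoothSection.integrable_mul {J : ℂ} (hJ : J.re = -((d : ℝ) + 1) / 2)
    {Ψ : (Fin (d + 1) → ℂ) → ℂ} (hΨ : Ψ ∈ SmoothSection d J) (f : 𝓢(Fin (d + 1) → ℂ, ℂ)) :
    Integrable (fun x => Ψ x * f x) := by
  obtain ⟨C, hC0, hC⟩ := hΨ.1.exists_norm_le hJ hΨ.2.continuousOn
  refine ((integrable_schwartz_mul_norm_rpow f).const_mul C).mono'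
    ((aestronglyMeasurable_of_continuousOn_compl hΨ.2.continuousOn).mul
      f.continuous.aestronglyMeasurable) (.of_forall fun x => ?_)
  rw [norm_mul, mul_left_comm, mul_comm]
  gcongr
  exact hC x

lemma snoc_one_ne_zero (z : Fin d → ℂ) : (Fin.snoc z 1 : Fin (d + 1) → ℂ) ≠ 0 := fun h => by
  simpa using congrFun h (Fin.last d)

lemma continuous_snoc_one : Continuous fun z : Fin d → ℂ => (Fin.snoc z 1 : Fin (d + 1) → ℂ) := by
  refine continuous_pi fun i => ?_
  refine Fin.lastCases ?_ (fun j => ?_) i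
  · simpa using continuous_const
  · simpa using continuous_apply j

lemma one_add_norm_le_two_mul_norm_snoc (z : Fin d → ℂ) :
    1 + ‖z‖ ≤ 2 * ‖(Fin.snoc z 1 : Fin (d + 1) → ℂ)‖ := by
  set x : Fin (d + 1) → ℂ := Fin.snoc z 1 with hx
  have hx1 : 1 ≤ ‖x‖ := by
    have := norm_le_pi_norm x (Fin.last d)
    simpa [hx] using this
  have hxz : ‖z‖ ≤ ‖x‖ := (pi_norm_le_iff_of_nonneg (norm_nonneg _)).2 fun i => by
    have := norm_le_pi_norm x i.castSucc
    simpa [hx] using this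
  linarith

/-- Both factors decay like `(1 + ‖z‖)^{-(d+1)}`, and `2 * (d + 1)` exceeds the real dimension `2 *
d`. This is the hypothesis of Fubini for the Mellin transform along the chart. -/
lemma SmoothSection.integrable_chart_mul {J : ℂ} (hJ : J.re = -((d : ℝ) + 1) / 2)
    {Ψ : (Fin (d + 1) → ℂ) → ℂ} (hΨ : Ψ ∈ SmoothSection d J) :
    Integrable (fun z : Fin d → ℂ =>
      ‖chart Ψ z‖ * ‖(Fin.snoc z 1 : Fin (d + 1) → ℂ)‖ ^ (-((d : ℝ) + 1))) := by
  obtain ⟨C, hC0, hC⟩ := hΨ.1.exists_norm_le hJ hΨ.2.continuousOn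
  have hd : (0 : ℝ) ≤ d := d.cast_nonneg
  have hc : Continuous (chart Ψ) :=
    hΨ.2.continuousOn.comp_continuous continuous_snoc_one snoc_one_ne_zero
  refine Integrable.mono' ((integrable_one_add_norm (μ := (volume : Measure (Fin d → ℂ)))
    (r := 2 * ((d : ℝ) + 1)) ?_).const_mul (C * 2 ^ (2 * ((d : ℝ) + 1)))) ?_ ?_
  · rw [finrank_complex_pi]; push_cast; linarith
  · exact (hc.norm.measurable.mul
      (continuous_snoc_one.norm.measurable.pow_const _)).aestronglyMeasurable
  · refine .of_forall fun z => ?_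
    set x : Fin (d + 1) → ℂ := Fin.snoc z 1 with hx
    have hx0 : 0 < ‖x‖ := norm_pos_iff.2 (snoc_one_ne_zero z)
    have h1 : (2 * ‖x‖) ^ (-(2 * ((d : ℝ) + 1))) ≤ (1 + ‖z‖) ^ (-(2 * ((d : ℝ) + 1))) :=
      Real.rpow_le_rpow_of_nonpos (by positivity) (one_add_norm_le_two_mul_norm_snoc z)
        (by linarith)
    rw [Real.norm_of_nonneg (by positivity)]
    calc ‖chart Ψ z‖ * ‖x‖ ^ (-((d : ℝ) + 1))
        ≤ (C * ‖x‖ ^ (-((d : ℝ) + 1))) * ‖x‖ ^ (-((d : ℝ) + 1)) := by gcongr; exact hC x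
      _ = C * 2 ^ (2 * ((d : ℝ) + 1)) * (2 * ‖x‖) ^ (-(2 * ((d : ℝ) + 1))) := by
          rw [Real.mul_rpow zero_le_two hx0.le, mul_assoc C, mul_assoc C, ← mul_assoc (2 ^ _),
            ← Real.rpow_add two_pos, ← Real.rpow_add hx0]
          ring_nf
          simp
      _ ≤ _ := by gcongr

lemma snoc_smul_self (w : ℂ) (z : Fin d → ℂ) :
    (Fin.snoc (w • z) w : Fin (d + 1) → ℂ) = w • (Fin.snoc z 1 : Fin (d + 1) → ℂ) := by
  ext i
  refine Fin.lastCases ?_ (fun j => ?_) i <;> simp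

lemma integral_eq_integral_snoc {G : (Fin (d + 1) → ℂ) → ℂ} (hG : Integrable G) :
    ∫ x, G x = ∫ w : ℂ, ∫ z : Fin d → ℂ, G (Fin.snoc z w : Fin (d + 1) → ℂ) := by
  have hm := (volume_preserving_piFinSuccAbove (fun _ : Fin (d + 1) => ℂ) (Fin.last d)).symm
  rw [← hm.integral_comp (MeasurableEquiv.measurableEmbedding _) G]
  have hi := (hm.integrable_comp_emb (MeasurableEquiv.measurableEmbedding _)).2 hG
  have := integral_prod _ hi
  simpa [MeasurableEquiv.piFinSuccAbove_symm_apply, Fin.insertNthEquiv, Fin.insertNth_last',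
    Measure.volume_eq_prod] using this

lemma mellinKernel_dualDegree {J w : ℂ} (hw : w ≠ 0) :
    mellinKernel (dualDegree d J) w = (‖w‖ : ℂ) ^ (2 * d) * (‖w‖ : ℂ) ^ (2 * J) := by
  have h : (‖w‖ : ℂ) ≠ 0 := by simpa using hw
  rw [mellinKernel, dualDegree, ← Complex.cpow_natCast, ← Complex.cpow_add _ _ h]
  congr 1
  push_cast
  ring

lemma two_mul_re_of_critical {J : ℂ} (hJ : J.re = -((d : ℝ) + 1) / 2) :
    2 * J.re = -((d : ℝ) + 1) := by
  rw [hJ]; ring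

/-- Integration of a homogeneous function against a test function, carried out in the chart. -/
lemma integral_mul_eq_integral_chart {J : ℂ} (hJ : J.re = -((d : ℝ) + 1) / 2)
    {Ψ : (Fin (d + 1) → ℂ) → ℂ} (hΨ : Ψ ∈ SmoothSection d J) (h : 𝓢(Fin (d + 1) → ℂ, ℂ)) :
    ∫ x, Ψ x * h x =
      ∫ z : Fin d → ℂ, chart Ψ z * chart (mellinTransform (dualDegree d J) h) z := by
  have hJ' := dualDegree_re hJ
  have hc : Continuous (chart Ψ) :=
    hΨ.2.continuousOn.comp_continuous continuous_snoc_one snoc_one_ne_zero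
  have h1 := integral_mul_mellinTransform (μ := (volume : Measure (Fin d → ℂ)))
    (re_neg_of_critical hJ') h (A := chart Ψ)
    (p := fun z => (Fin.snoc z 1 : Fin (d + 1) → ℂ)) hc.aestronglyMeasurable
    continuous_snoc_one.measurable (.of_forall snoc_one_ne_zero)
    (by simpa only [two_mul_re_of_critical hJ'] using SmoothSection.integrable_chart_mul hJ hΨ)
  change _ = ∫ z : Fin d → ℂ, chart Ψ z * mellinTransform (dualDegree d J) h _
  rw [h1, integral_eq_integral_snoc (SmoothSection.integrable_mul hJ hΨ h)]
  refine integral_congr_ae ?_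
  filter_upwards [compl_mem_ae_iff.2 (measure_singleton (0 : ℂ))] with w hw
  have hw0 : w ≠ 0 := hw
  -- On the slice with last coordinate `w`, rescaling `z` by `w` gives the Jacobian `|w|^{2d}` and
  -- homogeneity gives `|w|^{2J}`. Their product is the Mellin kernel of the dual degree, since
  -- `-2J̄ - 2 = 2J + 2d`.
  have h2 := integral_comp_complex_smul hw0
    (fun z : Fin d → ℂ => Ψ (Fin.snoc z w : Fin (d + 1) → ℂ) * h (Fin.snoc z w : Fin (d + 1) → ℂ))
  have hn : (‖w‖ : ℂ) ≠ 0 := by simpa using hw0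
  rw [Complex.real_smul] at h2
  push_cast at h2
  rw [eq_inv_mul_iff_mul_eq₀ (pow_ne_zero _ hn), Fintype.card_fin] at h2
  rw [← h2, mellinKernel_dualDegree hw0, mul_assoc]
  congr 1
  rw [← integral_const_mul]
  congr 1 with z
  rw [snoc_smul_self, hΨ.1.2 w _ hw0, chart, mul_assoc]

lemma dualDegree_dualDegree (J : ℂ) : dualDegree d (dualDegree d J) = J := by
  simp only [dualDegree]; ring

/-- Both sides equal the integral over `ℂ^d` of the product of the two charts, an expression
symmetric under exchanging `(J, g)` and `(J̄, h)`. -/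
lemma integral_mellinTransform_mul {J : ℂ} (hJ : J.re = -((d : ℝ) + 1) / 2)
    (g h : 𝓢(Fin (d + 1) → ℂ, ℂ)) :
    ∫ x, mellinTransform J g x * h x =
      ∫ x, g x * mellinTransform (dualDegree d J) h x := by
  have hJ' := dualDegree_re hJ
  rw [integral_mul_eq_integral_chart hJ (mellinTransform_mem (re_neg_of_critical hJ) g)]
  simp only [mul_comm (g _)]
  rw [integral_mul_eq_integral_chart hJ' (mellinTransform_mem (re_neg_of_critical hJ') h),
    dualDegree_dualDegree]
  simp only [mul_comm]

lemma integral_schwartz_mul_mellinTransform {J : ℂ} (hJ : J.re = -((d : ℝ) + 1) / 2)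
    (f h : 𝓢(Fin (d + 1) → ℂ, ℂ)) :
    ∫ x, f x * mellinTransform J h x = ∫ w, mellinKernel J w * ∫ x, f x * h (w • x) := by
  refine integral_mul_mellinTransform (p := id) (re_neg_of_critical hJ) h
    f.continuous.aestronglyMeasurable measurable_id
    (compl_mem_ae_iff.2 (measure_singleton (0 : Fin (d + 1) → ℂ))) ?_
  simpa only [two_mul_re_of_critical hJ, id] using integrable_schwartz_mul_norm_rpow f

/-! ### The Fourier transform of test functions. -/

open scoped FourierTransform

/-- Real and imaginary parts of a complex vector, as a vector of a real Euclidean space. -/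
def realify (n : ℕ) : (Fin n → ℂ) ≃L[ℝ] EuclideanSpace ℝ (Fin n ⊕ Fin n) :=
  LinearEquiv.toContinuousLinearEquiv
    { toFun := fun x => WithLp.toLp 2 (Sum.elim (fun i => (x i).re) (fun i => (x i).im))
      invFun := fun v i => ⟨v (Sum.inl i), v (Sum.inr i)⟩
      map_add' := fun x y => by ext i; rcases i with i | i <;> simp
      map_smul' := fun c x => by ext i; rcases i with i | i <;> simp
      left_inv := fun x => by ext i; simp
      right_inv := fun v => by ext i; rcases i with i | i <;> simp }

@[simp] lemma realify_inl {n : ℕ} (x : Fin n → ℂ) (i : Fin n) :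
    realify n x (Sum.inl i) = (x i).re := rfl

@[simp] lemma realify_inr {n : ℕ} (x : Fin n → ℂ) (i : Fin n) :
    realify n x (Sum.inr i) = (x i).im := rfl

lemma measurePreserving_realify (n : ℕ) : MeasurePreserving (realify n) volume volume := by
  have h1 := volume_preserving_pi (ι := Fin n)
    fun _ => Complex.volume_preserving_equiv_real_prod
  have h2 := measurePreserving_arrowProdEquivProdArrow ℝ ℝ (Fin n)
    (fun _ => volume) (fun _ => volume)
  have h3 := (measurePreserving_sumPiEquivProdPi
    (fun _ : Fin n ⊕ Fin n => (volume : Measure ℝ))).symm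
  have h4 := PiLp.volume_preserving_toLp (Fin n ⊕ Fin n)
  have h5 := h4.comp (h3.comp (h2.comp h1))
  have he : (realify n : (Fin n → ℂ) → _) = WithLp.toLp 2 ∘
      (MeasurableEquiv.sumPiEquivProdPi fun _ : Fin n ⊕ Fin n => ℝ).symm ∘
      MeasurableEquiv.arrowProdEquivProdArrow ℝ ℝ (Fin n) ∘
      fun x i => Complex.measurableEquivRealProd (x i) := by
    funext x
    ext i
    rcases i with i | i
    exacts [rfl, rfl]
  rw [he]
  exact h5

/-- Exchange of real and imaginary parts, in each coordinate. -/
def swapReIm (n : ℕ) : (Fin n → ℂ) ≃L[ℝ] (Fin n → ℂ) :=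
  ContinuousLinearEquiv.piCongrRight fun _ =>
    (Complex.conjLIE.trans (rotation (Circle.exp (Real.pi / 2)))).toContinuousLinearEquiv

lemma swapReIm_apply {n : ℕ} (x : Fin n → ℂ) (i : Fin n) :
    swapReIm n x i = Complex.I * conj (x i) := by
  simp only [swapReIm, ContinuousLinearEquiv.piCongrRight_apply]
  change ((Circle.exp (Real.pi / 2) : Circle) : ℂ) * conj (x i) = _
  rw [Circle.coe_exp]
  simp [Complex.exp_pi_div_two_mul_I]

lemma measurePreserving_swapReIm (n : ℕ) : MeasurePreserving (swapReIm n) volume volume :=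
  volume_preserving_pi fun _ =>
    (Complex.conjLIE.trans (rotation (Circle.exp (Real.pi / 2)))).measurePreserving

/-- `Im (k x) = Re k Im x + Im k Re x`, so exchanging the parts of `x` yields the Euclidean inner
product. -/
lemma inner_realify_swapReIm {n : ℕ} (k x : Fin n → ℂ) :
    inner ℝ (realify n k) (realify n (swapReIm n x)) = ∑ r, (k r * x r).im := by
  rw [PiLp.inner_apply, Fintype.sum_sum_type, ← Finset.sum_add_distrib]
  refine Finset.sum_congr rfl fun r _ => ?_
  simp [swapReIm_apply]
  ring

lemma prod_exp_eq (k x : Fin (d + 1) → ℂ) :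
    ∏ r, Complex.exp (-2 * Complex.I * ((k r * x r).im : ℂ)) =
      Complex.exp (((-2 * ∑ r, (k r * x r).im : ℝ) : ℂ) * Complex.I) := by
  rw [← Complex.exp_sum]
  congr 1
  push_cast
  rw [Finset.mul_sum, Finset.sum_mul]
  exact Finset.sum_congr rfl fun r _ => by ring

/-- The linear change of variables that turns `testFourier` into the Fourier transform of a
Euclidean space. -/
def dualRealify (d : ℕ) :
    (Fin (d + 1) → ℂ) ≃L[ℝ] EuclideanSpace ℝ (Fin (d + 1) ⊕ Fin (d + 1)) :=
  ((swapReIm (d + 1)).trans (realify (d + 1))).trans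
    (ContinuousLinearEquiv.smulLeft (Units.mk0 (Real.pi⁻¹) (inv_ne_zero Real.pi_ne_zero)))

lemma dualRealify_apply (x : Fin (d + 1) → ℂ) :
    dualRealify d x = Real.pi⁻¹ • realify (d + 1) (swapReIm (d + 1) x) := rfl

/-- A test function, transported to the real Euclidean space. -/
def realifyTest (f : 𝓢(Fin (d + 1) → ℂ, ℂ)) :
    𝓢(EuclideanSpace ℝ (Fin (d + 1) ⊕ Fin (d + 1)), ℂ) :=
  SchwartzMap.compCLMOfContinuousLinearEquiv ℂ (realify (d + 1)).symm f

/-- The scale `π⁻¹` in `dualRealify` turns the frequency `2π` of `𝓕` into the frequency `2` of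
`testFourier`. -/
lemma testFourier_eq_fourier (f : 𝓢(Fin (d + 1) → ℂ, ℂ)) (x : Fin (d + 1) → ℂ) :
    testFourier f x = ((Real.pi : ℂ) ^ (d + 1))⁻¹ * 𝓕 (realifyTest f) (dualRealify d x) := by
  rw [testFourier, SchwartzMap.fourier_coe, Real.fourier_eq',
    ← (measurePreserving_realify (d + 1)).integral_comp
      (realify (d + 1)).toHomeomorph.measurableEmbedding]
  congr 2 with k
  rw [prod_exp_eq, dualRealify_apply, inner_smul_right, inner_realify_swapReIm, smul_eq_mul,
    mul_comm]
  congr 4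
  field_simp

/-- `testFourier` as an operator on test functions. -/
def schwartzFourier (f : 𝓢(Fin (d + 1) → ℂ, ℂ)) : 𝓢(Fin (d + 1) → ℂ, ℂ) :=
  ((Real.pi : ℂ) ^ (d + 1))⁻¹ •
    SchwartzMap.compCLMOfContinuousLinearEquiv ℂ (dualRealify d) (𝓕 (realifyTest f))

lemma schwartzFourier_apply (f : 𝓢(Fin (d + 1) → ℂ, ℂ)) (x : Fin (d + 1) → ℂ) :
    schwartzFourier f x = testFourier f x := by
  rw [testFourier_eq_fourier]; rfl

/-- Fourier inversion. The two prefactors `π^{-(d+1)}` cancel the Jacobian `π^{2(d+1)}` of the scale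
`π⁻¹`, and two forward transforms leave a reflection. -/
lemma testFourier_schwartzFourier (f : 𝓢(Fin (d + 1) → ℂ, ℂ)) (x : Fin (d + 1) → ℂ) :
    testFourier (schwartzFourier f) x = f (-x) := by
  set Φ : EuclideanSpace ℝ (Fin (d + 1) ⊕ Fin (d + 1)) → ℂ := fun v =>
    Complex.exp (((-2 * Real.pi * inner ℝ v (realify (d + 1) x) : ℝ) : ℂ) * Complex.I) •
      𝓕 (realifyTest f) v with hΦ
  have h1 : ∀ k, schwartzFourier f k *
      ∏ r, Complex.exp (-2 * Complex.I * ((k r * x r).im : ℂ)) =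
      ((Real.pi : ℂ) ^ (d + 1))⁻¹ *
        Φ (Real.pi⁻¹ • realify (d + 1) (swapReIm (d + 1) k)) := fun k => by
    rw [schwartzFourier_apply, testFourier_eq_fourier, prod_exp_eq, hΦ, ← dualRealify_apply]
    simp only [dualRealify_apply]
    rw [inner_smul_left, real_inner_comm, inner_realify_swapReIm, smul_eq_mul, mul_assoc,
      mul_comm (𝓕 (realifyTest f) _)]
    congr 4
    simp only [mul_comm (x _)]
    simp
    field_simp
  have h2 : ∫ k, Φ (Real.pi⁻¹ • realify (d + 1) (swapReIm (d + 1) k)) =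
      (Real.pi : ℂ) ^ (2 * (d + 1)) * ∫ v, Φ v := by
    rw [(measurePreserving_swapReIm (d + 1)).integral_comp
      (swapReIm (d + 1)).toHomeomorph.measurableEmbedding
      (fun k => Φ (Real.pi⁻¹ • realify (d + 1) k)),
      (measurePreserving_realify (d + 1)).integral_comp
      (realify (d + 1)).toHomeomorph.measurableEmbedding (fun v => Φ (Real.pi⁻¹ • v)),
      Measure.integral_comp_smul, Complex.real_smul]
    congr 1
    have : Fintype.card (Fin (d + 1) ⊕ Fin (d + 1)) = 2 * (d + 1) := by
      simp; ring
    rw [finrank_euclideanSpace, this, inv_pow, inv_inv, abs_of_pos (by positivity)]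
    push_cast
    rfl
  have h3 : ∫ v, Φ v = f (-x) := by
    have h4 : ∫ v, Φ v = 𝓕 (𝓕 (realifyTest f)) (realify (d + 1) x) := by
      rw [SchwartzMap.fourier_coe (𝓕 (realifyTest f)), Real.fourier_eq']
    -- Inversion at the reflected point, because `𝓕⁻` is `𝓕` evaluated at the negative.
    have h5 : (𝓕⁻ (𝓕 (realifyTest f)) : 𝓢(EuclideanSpace ℝ (Fin (d + 1) ⊕ Fin (d + 1)), ℂ))
        (-realify (d + 1) x) = realifyTest f (-realify (d + 1) x) := by
      rw [FourierTransform.fourierInv_fourier_eq]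
    rw [SchwartzMap.fourierInv_apply_eq] at h5
    rw [h4]
    have h6 : 𝓕 (𝓕 (realifyTest f)) (realify (d + 1) x)
        = realifyTest f (-realify (d + 1) x) := by
      rw [← h5]
      exact congrArg _ (neg_neg _).symm
    rw [h6, ← map_neg]
    simp [realifyTest]
  rw [testFourier]
  simp only [h1]
  rw [integral_const_mul, h2, h3]
  have hp : (Real.pi : ℂ) ≠ 0 := by exact_mod_cast Real.pi_ne_zero
  field_simp
  ring

/-- Complex conjugate of a test function. -/
def schwartzConj (f : 𝓢(Fin (d + 1) → ℂ, ℂ)) : 𝓢(Fin (d + 1) → ℂ, ℂ) :=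
  SchwartzMap.postcompCLM (𝕜 := ℝ) (Complex.conjCLE : ℂ →L[ℝ] ℂ) f

lemma schwartzConj_apply (f : 𝓢(Fin (d + 1) → ℂ, ℂ)) (x : Fin (d + 1) → ℂ) :
    schwartzConj f x = conj (f x) := rfl

lemma testFourier_schwartzConj (f : 𝓢(Fin (d + 1) → ℂ, ℂ)) (x : Fin (d + 1) → ℂ) :
    testFourier (schwartzConj f) x = conj (testFourier f (-x)) := by
  rw [testFourier, testFourier, map_mul, ← integral_conj]
  congr 1
  · simp
  · congr 1 with k
    rw [map_mul, schwartzConj_apply, prod_exp_eq, prod_exp_eq, ← Complex.exp_conj, map_mul,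
      Complex.conj_ofReal, Complex.conj_I]
    simp only [Pi.neg_apply, mul_neg, Complex.neg_im, Finset.sum_neg_distrib, neg_mul, neg_neg,
      Complex.ofReal_neg]

lemma testFourier_conj_schwartzFourier (f : 𝓢(Fin (d + 1) → ℂ, ℂ)) (x : Fin (d + 1) → ℂ) :
    testFourier (schwartzConj (schwartzFourier f)) x = conj (f x) := by
  rw [testFourier_schwartzConj, testFourier_schwartzFourier, neg_neg]

/-- The bilinear form `2 Im(w Σ kᵣ xᵣ)`. -/
def dilatedPairing (d : ℕ) (w : ℂ) : (Fin (d + 1) → ℂ) →ₗ[ℝ] (Fin (d + 1) → ℂ) →ₗ[ℝ] ℝ :=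
  LinearMap.mk₂ ℝ (fun k x => 2 * ∑ r, (k r * (w * x r)).im)
    (fun k k' x => by simp only [Pi.add_apply, add_mul, Complex.add_im, Finset.sum_add_distrib,
      mul_add])
    (fun c k x => by
      simp only [Pi.smul_apply, smul_mul_assoc, Complex.smul_im, smul_eq_mul,
        ← Finset.mul_sum]
      ring)
    (fun k x x' => by simp only [Pi.add_apply, mul_add, Complex.add_im, Finset.sum_add_distrib])
    (fun c k x => by
      simp only [Pi.smul_apply, mul_smul_comm, Complex.smul_im, smul_eq_mul,
        ← Finset.mul_sum]
      ring)

lemma dilatedPairing_apply (w : ℂ) (k x : Fin (d + 1) → ℂ) :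
    dilatedPairing d w k x = 2 * ∑ r, (k r * (w * x r)).im := rfl

lemma testFourier_smul_eq (f : 𝓢(Fin (d + 1) → ℂ, ℂ)) (w : ℂ) (x : Fin (d + 1) → ℂ) :
    testFourier f (w • x) = ((Real.pi : ℂ) ^ (d + 1))⁻¹ *
      VectorFourier.fourierIntegral Real.probChar volume (dilatedPairing d w) f x := by
  rw [testFourier, VectorFourier.fourierIntegral_probChar]
  congr 2 with k
  rw [prod_exp_eq, dilatedPairing_apply, smul_eq_mul, mul_comm]
  simp

/-- The multiplication formula for a symmetric bilinear form. Placing the dilation in the form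
avoids a change of variables and covers `w = 0`. -/
lemma integral_testFourier_smul_mul (f g : 𝓢(Fin (d + 1) → ℂ, ℂ)) (w : ℂ) :
    ∫ k, testFourier g (w • k) * f k = ∫ x, g x * testFourier f (w • x) := by
  have hL : Continuous fun p : (Fin (d + 1) → ℂ) × (Fin (d + 1) → ℂ) =>
      dilatedPairing d w p.1 p.2 := by
    simp only [dilatedPairing_apply]
    fun_prop
  have hflip : (dilatedPairing d w).flip = dilatedPairing d w := by
    refine LinearMap.ext₂ fun k x => ?_
    simp only [LinearMap.flip_apply, dilatedPairing_apply]
    congr 2 with r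
    ring_nf
  have h := VectorFourier.integral_fourierIntegral_smul_eq_flip (μ := volume) (ν := volume)
    (L := dilatedPairing d w) Real.continuous_probChar hL g.integrable f.integrable
  rw [hflip] at h
  simp only [testFourier_smul_eq, smul_eq_mul, mul_assoc, mul_left_comm _ ((_ : ℂ)⁻¹),
    integral_const_mul] at h ⊢
  rw [h]

/-! ### Every smooth section is a Mellin transform. -/

/-- A bump function on the line, supported in `(1/2, 3/2)`. -/
def lineBump : ContDiffBump (1 : ℝ) := ⟨1 / 4, 1 / 2, by norm_num, by norm_num⟩

lemma lineBump_eq_zero {s : ℝ} (hs : s ≤ 1 / 2 ∨ 3 / 2 ≤ s) : lineBump s = 0 := by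
  refine lineBump.zero_of_le_dist ?_
  change 1 / 2 ≤ dist s 1
  rw [Real.dist_eq]
  rcases hs with hs | hs
  · rw [abs_of_nonpos] <;> linarith
  · rw [abs_of_nonneg] <;> linarith

lemma integral_lineBump_pos : 0 < ∫ w : ℂ, lineBump (‖w‖ ^ 2) := by
  refine Continuous.integral_pos_of_hasCompactSupport_nonneg_nonzero (x := 1)
    (lineBump.continuous.comp (by fun_prop)) ?_ (fun _ => lineBump.nonneg) ?_
  · refine HasCompactSupport.intro (isCompact_closedBall (0 : ℂ) 2) fun w hw => ?_
    refine lineBump_eq_zero (.inr ?_)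
    have : 2 < ‖w‖ := by simpa using hw
    nlinarith
  · have : lineBump (1 : ℝ) = 1 := lineBump.one_of_mem_closedBall (by simp [lineBump])
    simp [this]

/-- The squared Euclidean norm of a complex vector. -/
def sumSq (x : Fin (d + 1) → ℂ) : ℝ := ∑ i, ‖x i‖ ^ 2

lemma contDiff_sumSq : ContDiff ℝ ∞ (sumSq (d := d)) := by
  refine ContDiff.sum fun i _ => ?_
  exact (contDiff_norm_sq ℝ).comp (contDiff_apply ℝ ℂ i)

lemma sumSq_smul (w : ℂ) (x : Fin (d + 1) → ℂ) : sumSq (w • x) = ‖w‖ ^ 2 * sumSq x := by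
  simp [sumSq, mul_pow, Finset.mul_sum]

lemma sumSq_pos {x : Fin (d + 1) → ℂ} (hx : x ≠ 0) : 0 < sumSq x := by
  obtain ⟨i, hi⟩ := Function.ne_iff.1 hx
  have hi' : 0 < ‖x i‖ := norm_pos_iff.2 hi
  exact Finset.sum_pos' (fun _ _ => by positivity) ⟨i, Finset.mem_univ _, by positivity⟩

lemma norm_sq_le_sumSq (x : Fin (d + 1) → ℂ) : ‖x‖ ^ 2 ≤ sumSq x := by
  have h0 : 0 ≤ sumSq x := Finset.sum_nonneg fun _ _ => by positivity
  refine Real.le_sqrt (norm_nonneg _) h0 |>.1 ((pi_norm_le_iff_of_nonneg (Real.sqrt_nonneg _)).2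
    fun i => Real.le_sqrt (norm_nonneg _) h0 |>.2 ?_)
  exact Finset.single_le_sum (f := fun i => ‖x i‖ ^ 2) (fun _ _ => by positivity)
    (Finset.mem_univ i)

/-- A radial cutoff function, supported away from the origin. -/
def radialCutoff (x : Fin (d + 1) → ℂ) : ℝ := sumSq x * lineBump (sumSq x)

lemma contDiff_radialCutoff : ContDiff ℝ ∞ (radialCutoff (d := d)) :=
  contDiff_sumSq.mul (lineBump.contDiff.comp contDiff_sumSq)

lemma contDiff_radialCutoff_mul {Ψ : (Fin (d + 1) → ℂ) → ℂ} (hΨ : ContDiffOn ℝ ∞ Ψ {0}ᶜ) :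
    ContDiff ℝ ∞ (fun x => (radialCutoff x : ℂ) * Ψ x) := by
  refine contDiff_iff_contDiffAt.2 fun x => ?_
  by_cases hx : x = 0
  · have h1 : ∀ᶠ y in 𝓝 x, sumSq y < 1 / 2 :=
      contDiff_sumSq.continuous.continuousAt.eventually_lt continuousAt_const
        (by simp [hx, sumSq])
    refine (contDiffAt_const (c := (0 : ℂ))).congr_of_eventuallyEq ?_
    filter_upwards [h1] with y hy
    simp [radialCutoff, lineBump_eq_zero (.inl hy.le)]
  · exact (Complex.ofRealCLM.contDiff.contDiffAt.comp x contDiff_radialCutoff.contDiffAt).mul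
      (hΨ.contDiffAt (isOpen_compl_singleton.mem_nhds hx))

lemma hasCompactSupport_radialCutoff_mul (Ψ : (Fin (d + 1) → ℂ) → ℂ) :
    HasCompactSupport (fun x => (radialCutoff x : ℂ) * Ψ x) := by
  refine HasCompactSupport.intro (isCompact_closedBall (0 : Fin (d + 1) → ℂ) 2) fun x hx => ?_
  have h1 : 2 < ‖x‖ := by simpa using hx
  have h2 := norm_sq_le_sumSq x
  have h3 : lineBump (sumSq x) = 0 := lineBump_eq_zero (.inr (by nlinarith))
  simp [radialCutoff, h3]

/-- Homogeneity of `Ψ` reduces the kernel to `|w|^{-2}`, which the factor `sumSq` of the cutoff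
cancels. Rescaling `w` by `√(sumSq x)` then removes the dependence on `x`, leaving a positive
constant. -/
lemma mellinTransform_radialCutoff_mul {J : ℂ} {Ψ : (Fin (d + 1) → ℂ) → ℂ}
    (hΨ : IsHomogeneous J Ψ) (x : Fin (d + 1) → ℂ) :
    mellinTransform J (fun x => (radialCutoff x : ℂ) * Ψ x) x =
      ((∫ w : ℂ, lineBump (‖w‖ ^ 2) : ℝ) : ℂ) * Ψ x := by
  by_cases hx : x = 0
  · simp [mellinTransform, hx, hΨ.1]
  have hq := sumSq_pos hx
  have hr := Real.sqrt_pos.2 hq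
  have hr0 : ((Real.sqrt (sumSq x) : ℝ) : ℂ) ≠ 0 := by exact_mod_cast hr.ne'
  rw [mellinTransform, if_neg hx]
  have h1 : ∫ w : ℂ, mellinKernel J w * ((radialCutoff (w • x) : ℂ) * Ψ (w • x)) =
      ∫ w : ℂ, ((sumSq x * lineBump (‖((Real.sqrt (sumSq x) : ℝ) : ℂ) * w‖ ^ 2) : ℝ) : ℂ) *
        Ψ x := by
    refine integral_congr_ae ?_
    filter_upwards [compl_mem_ae_iff.2 (measure_singleton (0 : ℂ))] with w hw
    have hw0 : w ≠ 0 := hw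
    have hn : (‖w‖ : ℂ) ≠ 0 := by simpa using hw0
    have h2 : mellinKernel J w * (‖w‖ : ℂ) ^ (2 * J) * (‖w‖ : ℂ) ^ 2 = 1 := by
      rw [mellinKernel, ← Complex.cpow_natCast, ← Complex.cpow_add _ _ hn,
        ← Complex.cpow_add _ _ hn, ← Complex.cpow_zero (‖w‖ : ℂ)]
      congr 1
      push_cast
      ring
    rw [hΨ.2 w x hw0, radialCutoff, sumSq_smul, norm_mul, mul_pow, Complex.norm_real,
      Real.norm_of_nonneg hr.le, Real.sq_sqrt hq.le, mul_comm (sumSq x) (‖w‖ ^ 2)]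
    push_cast
    linear_combination (sumSq x * lineBump (‖w‖ ^ 2 * sumSq x) * Ψ x : ℂ) * h2
  rw [h1, integral_mul_const, integral_complex_ofReal, integral_const_mul,
    integral_comp_complex_mul hr0 (fun w => lineBump (‖w‖ ^ 2)), Complex.norm_real,
    Real.norm_of_nonneg hr.le, Real.sq_sqrt hq.le, smul_eq_mul, mul_inv_cancel_left₀ hq.ne']

lemma exists_mellinTransform_eq {J : ℂ} {Ψ : (Fin (d + 1) → ℂ) → ℂ}
    (hΨ : Ψ ∈ SmoothSection d J) :
    ∃ g : 𝓢(Fin (d + 1) → ℂ, ℂ), mellinTransform J g = Ψ := by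
  set c : ℂ := ((∫ w : ℂ, lineBump (‖w‖ ^ 2) : ℝ) : ℂ) with hc
  have hc0 : c ≠ 0 := Complex.ofReal_ne_zero.2 integral_lineBump_pos.ne'
  have hm : c⁻¹ • Ψ ∈ SmoothSection d J := Submodule.smul_mem _ _ hΨ
  refine ⟨(hasCompactSupport_radialCutoff_mul (c⁻¹ • Ψ)).toSchwartzMap
    (contDiff_radialCutoff_mul hm.2), ?_⟩
  funext x
  refine (mellinTransform_radialCutoff_mul hm.1 x).trans ?_
  rw [← hc, Pi.smul_apply, smul_eq_mul, mul_inv_cancel_left₀ hc0]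

/-! ### Existence of the transform and preservation of the norm. -/

lemma conj_dualDegree {J : ℂ} (hJ : J.re = -((d : ℝ) + 1) / 2) : conj J = dualDegree d J := by
  apply Complex.ext
  · rw [dualDegree_re hJ, Complex.conj_re, hJ]
  · simp [dualDegree]

lemma SmoothSection.conj_mem {J : ℂ} (hJ : J.re = -((d : ℝ) + 1) / 2)
    {Ψ : (Fin (d + 1) → ℂ) → ℂ} (hΨ : Ψ ∈ SmoothSection d J) :
    (fun x => conj (Ψ x)) ∈ SmoothSection d (dualDegree d J) := by
  refine ⟨⟨by simp [hΨ.1.1], fun ρ x hρ => ?_⟩,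
    Complex.conjCLE.contDiff.comp_contDiffOn hΨ.2⟩
  change conj (Ψ (ρ • x)) = _ * conj (Ψ x)
  have harg : (‖ρ‖ : ℂ).arg ≠ Real.pi := by
    rw [Complex.arg_ofReal_of_nonneg (norm_nonneg _)]
    exact Real.pi_pos.ne
  rw [hΨ.1.2 ρ x hρ, map_mul, ← conj_dualDegree hJ,
    show 2 * conj J = conj (2 * J) by rw [map_mul, Complex.conj_ofNat],
    Complex.cpow_conj _ _ harg, Complex.conj_ofReal]

lemma integral_conj_mul_self {α : Type*} [MeasurableSpace α] {μ : Measure α} (f : α → ℂ) :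
    ∫ z, conj (f z) * f z ∂μ = ((∫ z, ‖f z‖ ^ 2 ∂μ : ℝ) : ℂ) := by
  rw [← integral_complex_ofReal]
  congr 1 with z
  rw [Complex.conj_mul']
  simp

/-- The duality moves the Mellin transform from `g` to `f̂`. Fubini then writes both sides as
integrals over `w` against the same kernel, and the inner integrals agree by the multiplication
formula. -/
lemma isFourierTransform_mellinTransform {J : ℂ} (hJ : J.re = -((d : ℝ) + 1) / 2)
    (g : 𝓢(Fin (d + 1) → ℂ, ℂ)) :
    IsFourierTransform (mellinTransform J g)
      (mellinTransform (dualDegree d J) (schwartzFourier g)) := by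
  have hJ' := dualDegree_re hJ
  refine ⟨SmoothSection.integrable_mul hJ (mellinTransform_mem (re_neg_of_critical hJ) g),
    SmoothSection.integrable_mul hJ' (mellinTransform_mem (re_neg_of_critical hJ') _),
    fun f => ?_⟩
  simp only [← schwartzFourier_apply f]
  rw [integral_mellinTransform_mul hJ, integral_schwartz_mul_mellinTransform hJ']
  simp only [mul_comm _ (f _)]
  rw [integral_schwartz_mul_mellinTransform hJ']
  congr 1 with w
  have := integral_testFourier_smul_mul f g w
  simp only [schwartzFourier_apply, ← this, mul_comm (f _)]

/-- Testing with `conj ĝ` and conjugating gives `∫ conj Φ * ĝ = ∫ conj Ψ * g`. The chart formula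
applies to the sections `conj Φ` of degree `J` and `conj Ψ` of degree `J̄`, and returns `Φ` and `Ψ`
as the Mellin transforms of `ĝ` and `g`. -/
lemma integral_norm_chart_mellinTransform {J : ℂ} (hJ : J.re = -((d : ℝ) + 1) / 2)
    (g : 𝓢(Fin (d + 1) → ℂ, ℂ)) :
    ∫ z : Fin d → ℂ, ‖chart (mellinTransform (dualDegree d J) (schwartzFourier g)) z‖ ^ 2 =
      ∫ z : Fin d → ℂ, ‖chart (mellinTransform J g) z‖ ^ 2 := by
  have hJ' := dualDegree_re hJ
  set Ψ := mellinTransform J g with hΨ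
  set Φ := mellinTransform (dualDegree d J) (schwartzFourier g) with hΦ
  have hΨm : Ψ ∈ SmoothSection d J := mellinTransform_mem (re_neg_of_critical hJ) _
  have hΦm : Φ ∈ SmoothSection d (dualDegree d J) :=
    mellinTransform_mem (re_neg_of_critical hJ') _
  have hΦc := SmoothSection.conj_mem hJ' hΦm
  rw [dualDegree_dualDegree] at hΦc
  have h1 := integral_mul_eq_integral_chart hJ hΦc (schwartzFourier g)
  have h2 := integral_mul_eq_integral_chart hJ' (SmoothSection.conj_mem hJ hΨm) g
  rw [dualDegree_dualDegree, ← hΨ] at h2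
  rw [← hΦ] at h1
  have h3 := congrArg conj ((isFourierTransform_mellinTransform hJ g).2.2
    (schwartzConj (schwartzFourier g)))
  rw [← integral_conj, ← integral_conj] at h3
  simp only [testFourier_conj_schwartzFourier, schwartzConj_apply, map_mul, Complex.conj_conj]
    at h3
  rw [h1, h2] at h3
  have h4 := (integral_conj_mul_self (μ := volume) (chart Φ)).symm.trans
    (h3.trans (integral_conj_mul_self (μ := volume) (chart Ψ)))
  exact_mod_cast h4

lemma exists_fourierTransform {J : ℂ} (hJ : J.re = -((d : ℝ) + 1) / 2)
    (Ψ : SmoothSection d J) : ∃ Φ : SmoothSection d (dualDegree d J),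
      IsFourierTransform Ψ.1 Φ.1 ∧
      ∫ z : Fin d → ℂ, ‖chart Φ.1 z‖ ^ 2 = ∫ z : Fin d → ℂ, ‖chart Ψ.1 z‖ ^ 2 := by
  obtain ⟨Ψ, hΨ⟩ := Ψ
  obtain ⟨g, rfl⟩ := exists_mellinTransform_eq hΨ
  exact ⟨⟨_, mellinTransform_mem (re_neg_of_critical (dualDegree_re hJ)) (schwartzFourier g)⟩,
    isFourierTransform_mellinTransform hJ g, integral_norm_chart_mellinTransform hJ g⟩

/-! ### Uniqueness, linearity and bijectivity. -/

/-- Test functions supported off the origin show that the difference vanishes almost everywhere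
there; by continuity it vanishes everywhere there. -/
lemma SmoothSection.eq_of_integral_mul_eq {J : ℂ} (hJ : J.re = -((d : ℝ) + 1) / 2)
    {Ψ Φ : SmoothSection d J}
    (h : ∀ f : 𝓢(Fin (d + 1) → ℂ, ℂ), ∫ x, Ψ.1 x * f x = ∫ x, Φ.1 x * f x) : Ψ = Φ := by
  have hc : ContinuousOn (Ψ - Φ).1 {0}ᶜ := (Ψ - Φ).2.2.continuousOn
  have hae := IsOpen.ae_eq_zero_of_integral_contDiff_smul_eq_zero (μ := volume)
    (isOpen_compl_singleton (x := (0 : Fin (d + 1) → ℂ)))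
    (hc.locallyIntegrableOn (measurableSet_singleton 0).compl) fun g hg hgc _ => by
      have hg' : HasCompactSupport (fun x => (g x : ℂ)) :=
        hgc.comp_left (g := fun t : ℝ => (t : ℂ)) Complex.ofReal_zero
      have h1 := h (hg'.toSchwartzMap (Complex.ofRealCLM.contDiff.comp hg))
      have h2 := SmoothSection.integrable_mul hJ Ψ.2
        (hg'.toSchwartzMap (Complex.ofRealCLM.contDiff.comp hg))
      have h3 := SmoothSection.integrable_mul hJ Φ.2
        (hg'.toSchwartzMap (Complex.ofRealCLM.contDiff.comp hg))
      rw [← sub_eq_zero, ← integral_sub h2 h3] at h1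
      rw [← h1]
      congr 1 with x
      change (g x) • (Ψ.1 x - Φ.1 x) = Ψ.1 x * (g x : ℂ) - Φ.1 x * (g x : ℂ)
      rw [Complex.real_smul]
      ring
  have heq : EqOn (Ψ - Φ).1 0 {0}ᶜ := by
    refine Measure.eqOn_open_of_ae_eq (μ := volume) ?_ isOpen_compl_singleton hc continuousOn_const
    exact (ae_restrict_iff' (measurableSet_singleton 0).compl).2 hae
  refine Subtype.ext (funext fun x => ?_)
  -- At the origin both sections take the default value zero.
  by_cases hx : x = 0
  · rw [hx, Ψ.2.1.1, Φ.2.1.1]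
  · exact sub_eq_zero.1 (heq hx)

lemma IsHomogeneous.neg_apply {J : ℂ} {Ψ : (Fin (d + 1) → ℂ) → ℂ} (h : IsHomogeneous J Ψ)
    (x : Fin (d + 1) → ℂ) : Ψ (-x) = Ψ x := by
  simpa using h.2 (-1) x (by simp)

/-- Testing against `f̂` produces `f(-x)`, and the reflection is absorbed because homogeneous
functions are even. -/
lemma IsFourierTransform.symm {J : ℂ} {Ψ Φ : (Fin (d + 1) → ℂ) → ℂ} (hΨ : IsHomogeneous J Ψ)
    (h : IsFourierTransform Ψ Φ) : IsFourierTransform Φ Ψ := by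
  refine ⟨h.2.1, h.1, fun f => ?_⟩
  have h1 := h.2.2 (schwartzFourier f)
  simp only [testFourier_schwartzFourier, schwartzFourier_apply] at h1
  rw [h1, ← integral_neg_eq_self]
  simp only [hΨ.neg_apply]

lemma IsFourierTransform.add {Ψ Φ Ψ' Φ' : (Fin (d + 1) → ℂ) → ℂ} (h : IsFourierTransform Ψ Φ)
    (h' : IsFourierTransform Ψ' Φ') : IsFourierTransform (Ψ + Ψ') (Φ + Φ') := by
  have e : ∀ A B : (Fin (d + 1) → ℂ) → ℂ, ∀ f : (Fin (d + 1) → ℂ) → ℂ,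
      (fun x => (A + B) x * f x) = fun x => A x * f x + B x * f x :=
    fun A B f => funext fun x => add_mul _ _ _
  refine ⟨fun f => ?_, fun f => ?_, fun f => ?_⟩
  · rw [e]; exact (h.1 f).add (h'.1 f)
  · rw [e]; exact (h.2.1 f).add (h'.2.1 f)
  · rw [e, e, integral_add (h.2.1 f) (h'.2.1 f), h.2.2, h'.2.2]
    simp only [← schwartzFourier_apply]
    rw [integral_add (h.1 _) (h'.1 _)]

lemma IsFourierTransform.const_smul {Ψ Φ : (Fin (d + 1) → ℂ) → ℂ} (c : ℂ)
    (h : IsFourierTransform Ψ Φ) : IsFourierTransform (c • Ψ) (c • Φ) := by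
  have e : ∀ A : (Fin (d + 1) → ℂ) → ℂ, ∀ f : (Fin (d + 1) → ℂ) → ℂ,
      (fun x => (c • A) x * f x) = fun x => c * (A x * f x) :=
    fun A f => funext fun x => mul_assoc _ _ _
  refine ⟨fun f => ?_, fun f => ?_, fun f => ?_⟩
  · rw [e]; exact (h.1 f).const_mul c
  · rw [e]; exact (h.2.1 f).const_mul c
  · rw [e, e, integral_const_mul, integral_const_mul, h.2.2]

lemma IsFourierTransform.unique {J : ℂ} (hJ : J.re = -((d : ℝ) + 1) / 2)
    {Ψ : (Fin (d + 1) → ℂ) → ℂ} {Φ Φ' : SmoothSection d J} (h : IsFourierTransform Ψ Φ.1)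
    (h' : IsFourierTransform Ψ Φ'.1) : Φ = Φ' :=
  SmoothSection.eq_of_integral_mul_eq hJ fun f => (h.2.2 f).trans (h'.2.2 f).symm

/-- The Fourier transform of smooth sections on the critical line. -/
def sectionFourier {J : ℂ} (hJ : J.re = -((d : ℝ) + 1) / 2) :
    SmoothSection d J →ₗ[ℂ] SmoothSection d (dualDegree d J) where
  toFun Ψ := (exists_fourierTransform hJ Ψ).choose
  map_add' Ψ Ψ' := IsFourierTransform.unique (dualDegree_re hJ)
    (exists_fourierTransform hJ _).choose_spec.1
    ((exists_fourierTransform hJ Ψ).choose_spec.1.add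
      (exists_fourierTransform hJ Ψ').choose_spec.1)
  map_smul' c Ψ := IsFourierTransform.unique (dualDegree_re hJ)
    (exists_fourierTransform hJ _).choose_spec.1
    ((exists_fourierTransform hJ Ψ).choose_spec.1.const_smul c)

lemma isFourierTransform_sectionFourier {J : ℂ} (hJ : J.re = -((d : ℝ) + 1) / 2)
    (Ψ : SmoothSection d J) : IsFourierTransform Ψ.1 (sectionFourier hJ Ψ).1 :=
  (exists_fourierTransform hJ Ψ).choose_spec.1

lemma integral_norm_chart_sectionFourier {J : ℂ} (hJ : J.re = -((d : ℝ) + 1) / 2)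
    (Ψ : SmoothSection d J) : ∫ z : Fin d → ℂ, ‖chart (sectionFourier hJ Ψ).1 z‖ ^ 2 =
      ∫ z : Fin d → ℂ, ‖chart Ψ.1 z‖ ^ 2 :=
  (exists_fourierTransform hJ Ψ).choose_spec.2

lemma bijective_sectionFourier {J : ℂ} (hJ : J.re = -((d : ℝ) + 1) / 2) :
    Function.Bijective (sectionFourier hJ) := by
  refine ⟨fun Ψ Ψ' h => ?_, fun Φ => ?_⟩
  · have h1 := (isFourierTransform_sectionFourier hJ Ψ).symm Ψ.2.1
    rw [h] at h1
    exact h1.unique hJ ((isFourierTransform_sectionFourier hJ Ψ').symm Ψ'.2.1)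
  · obtain ⟨⟨Ψ, hΨ⟩, h, -⟩ := exists_fourierTransform (dualDegree_re hJ) Φ
    rw [dualDegree_dualDegree] at hΨ
    exact ⟨⟨Ψ, hΨ⟩, (isFourierTransform_sectionFourier hJ _).unique (dualDegree_re hJ)
      (h.symm Φ.2.1)⟩

/-! ### Density of smooth sections and the Hilbert space norm. -/

lemma contDiffAt_ofReal_cpow (c : ℂ) {t : ℝ} (ht : 0 < t) :
    ContDiffAt ℝ ∞ (fun t : ℝ => (t : ℂ) ^ c) t := by
  have h1 : AnalyticAt ℂ (fun z : ℂ => z ^ c) (t : ℂ) :=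
    analyticAt_id.cpow analyticAt_const (Complex.ofReal_mem_slitPlane.2 ht)
  exact (h1.contDiffAt.restrict_scalars ℝ).comp t Complex.ofRealCLM.contDiff.contDiffAt

/-- The critical points lie on the hyperplane at infinity of the chart. Near them some affine
coordinate leaves the ball containing the support of `g`, so the section vanishes identically there.
-/
lemma ofChart_mem {J : ℂ} {g : (Fin d → ℂ) → ℂ} (hg : ContDiff ℝ ∞ g)
    (hgc : HasCompactSupport g) : ofChart J g ∈ SmoothSection d J := by
  refine ⟨isHomogeneous_ofChart J g, fun x hx => ContDiffAt.contDiffWithinAt ?_⟩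
  by_cases hl : x (Fin.last d) = 0
  · obtain ⟨R, hR⟩ := hgc.isCompact.isBounded.subset_closedBall 0
    -- This also disposes of `d = 0`, where the hyperplane is just the excluded origin.
    obtain ⟨i, hi⟩ : ∃ i : Fin d, x i.castSucc ≠ 0 := by
      by_contra! hcon
      refine hx (funext fun j => ?_)
      exact Fin.lastCases hl hcon j
    have h1 : ∀ᶠ y in 𝓝 x, R * ‖y (Fin.last d)‖ < ‖y i.castSucc‖ := by
      refine ContinuousAt.eventually_lt
        (continuous_const.mul (continuous_apply (Fin.last d)).norm).continuousAt
        (continuous_apply i.castSucc).norm.continuousAt ?_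
      simpa [hl] using hi
    refine (contDiffAt_const (c := (0 : ℂ))).congr_of_eventuallyEq ?_
    filter_upwards [h1] with y hy
    by_cases hy0 : y (Fin.last d) = 0
    · simp [ofChart, hy0]
    · rw [ofChart, if_neg hy0, image_eq_zero_of_notMem_tsupport (f := g), mul_zero]
      intro hmem
      have h2 := (norm_le_pi_norm _ i).trans (mem_closedBall_zero_iff.1 (hR hmem))
      rw [norm_div, div_le_iff₀ (norm_pos_iff.2 hy0)] at h2
      linarith
  · have h1 : ∀ᶠ y in 𝓝 x, y (Fin.last d) ≠ 0 :=
      (continuous_apply (Fin.last d)).continuousAt.eventually_ne hl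
    have h2 : ContDiffAt ℝ ∞ (fun y : Fin (d + 1) → ℂ =>
        ((‖y (Fin.last d)‖ : ℂ) ^ (2 * J)) *
          g (fun i => y i.castSucc / y (Fin.last d))) x := by
      refine ContDiffAt.mul ?_ ?_
      · exact (contDiffAt_ofReal_cpow (2 * J) (norm_pos_iff.2 hl)).comp x
          ((contDiffAt_norm ℝ hl).comp x (contDiff_apply ℝ ℂ (Fin.last d)).contDiffAt)
      · refine hg.contDiffAt.comp x (contDiffAt_pi.2 fun i => ?_)
        simp only [div_eq_mul_inv]
        exact (contDiff_apply ℝ ℂ _).contDiffAt.mul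
          ((contDiff_apply ℝ ℂ (Fin.last d)).contDiffAt.inv hl)
    refine h2.congr_of_eventuallyEq ?_
    filter_upwards [h1] with y hy
    rw [ofChart, if_neg hy]

/-- Smooth compactly supported functions are dense in `L²(ℂ^d)`, and each is the chart of a smooth
section. -/
lemma denseRange_toHilbert {J : ℂ} (hJ : J.re = -((d : ℝ) + 1) / 2) :
    DenseRange (toHilbert hJ) := by
  intro a
  obtain ⟨Ψ, rfl⟩ := SeparationQuotient.surjective_mk a
  refine (mem_closure_iff_nhds_basis Metric.nhds_basis_closedBall).2 fun ε hε => ?_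
  obtain ⟨g, hgc, hg, hle⟩ :=
    MemLp.exist_eLpNorm_sub_le ENNReal.ofNat_ne_top one_le_two Ψ.memLp hε
  set Φ : SmoothSection d J := ⟨ofChart J g, ofChart_mem hg hgc⟩
  refine ⟨toHilbert hJ Φ, mem_range_self _, ?_⟩
  set Φ' : PreHilbertSection d J := .mk ⟨Φ.1, smooth_le_squareIntegrable hJ Φ.2⟩
  have hch : chart (Ψ - Φ').fn = chart Ψ.fn - g := by
    rw [map_sub]
    change chart Ψ.fn - chart (ofChart J g) = _
    rw [chart_ofChart]
  rw [Metric.mem_closedBall, dist_comm]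
  change dist (SeparationQuotient.mk Ψ) (SeparationQuotient.mk Φ') ≤ ε
  rw [SeparationQuotient.dist_mk, dist_eq_norm, ← norm_toLp_eq, Lp.norm_toLp, hch]
  exact ENNReal.toReal_le_of_le_ofReal hε.le hle

lemma norm_toHilbert_sq {J : ℂ} (hJ : J.re = -((d : ℝ) + 1) / 2) (Ψ : SmoothSection d J) :
    ‖toHilbert hJ Ψ‖ ^ 2 = ∫ z : Fin d → ℂ, ‖chart Ψ.1 z‖ ^ 2 := by
  change ‖SeparationQuotient.mk _‖ ^ 2 = _
  rw [SeparationQuotient.norm_mk, norm_sq_eq]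
  rfl

lemma norm_toHilbert_sectionFourier {J : ℂ} (hJ : J.re = -((d : ℝ) + 1) / 2)
    (Ψ : SmoothSection d J) :
    ‖toHilbert (dualDegree_re hJ) (sectionFourier hJ Ψ)‖ = ‖toHilbert hJ Ψ‖ := by
  rw [← sq_eq_sq₀ (norm_nonneg _) (norm_nonneg _), norm_toHilbert_sq, norm_toHilbert_sq,
    integral_norm_chart_sectionFourier]

end ProjectiveFourier

end

theorem mainTheorem7 (d : ℕ) (J : ℂ) (hJ : J.re = -((d : ℝ) + 1) / 2) :
    ∃ F : ProjectiveFourier.SmoothSection d J →ₗ[ℂ]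
        ProjectiveFourier.SmoothSection d (ProjectiveFourier.dualDegree d J),
      (∀ (Ψ : ProjectiveFourier.TranslationInvariantSection d J)
          (Φ : ProjectiveFourier.SmoothSection d (ProjectiveFourier.dualDegree d J)),
        ProjectiveFourier.IsFourierTransform (ProjectiveFourier.reduce d J Ψ).1 Φ.1 ↔
          Φ = F (ProjectiveFourier.reduce d J Ψ)) ∧
      Function.Bijective F ∧
      (∀ Ψ : ProjectiveFourier.SmoothSection d J,
        ∫ z : Fin d → ℂ, ‖ProjectiveFourier.chart (F Ψ).1 z‖ ^ 2 =
          ∫ z : Fin d → ℂ, ‖ProjectiveFourier.chart Ψ.1 z‖ ^ 2) ∧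
      DenseRange (ProjectiveFourier.toHilbert hJ) ∧
      ∃! U : ProjectiveFourier.HilbertSection d J ≃ₗᵢ[ℂ]
          ProjectiveFourier.HilbertSection d (ProjectiveFourier.dualDegree d J),
        ∀ Ψ : ProjectiveFourier.SmoothSection d J,
          U (ProjectiveFourier.toHilbert hJ Ψ) =
            ProjectiveFourier.toHilbert (ProjectiveFourier.dualDegree_re hJ) (F Ψ) := by
  open ProjectiveFourier in
  have hd := denseRange_toHilbert hJ
  refine ⟨sectionFourier hJ, fun Ψ Φ => ⟨fun h => h.unique (dualDegree_re hJ)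
    (isFourierTransform_sectionFourier hJ _), fun h => h ▸ isFourierTransform_sectionFourier hJ _⟩,
    bijective_sectionFourier hJ, integral_norm_chart_sectionFourier hJ, hd, ?_⟩
  -- A norm-preserving bijection between dense subspaces extends to a unitary; density on the dual
  -- side makes the extension surjective.
  have hU₀ := LinearEquiv.extendOfIsometry_eq
    (LinearEquiv.ofBijective (sectionFourier hJ) (bijective_sectionFourier hJ))
    (toHilbert hJ) (toHilbert (dualDegree_re hJ)) hd (denseRange_toHilbert (dualDegree_re hJ))
    (norm_toHilbert_sectionFourier hJ)
  refine ⟨_, hU₀, fun U hU => ?_⟩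
  refine LinearIsometryEquiv.ext fun a => congrFun (hd.equalizer U.continuous
      (LinearIsometryEquiv.continuous _) (funext fun Ψ => ?_)) a
  exact (hU Ψ).trans (hU₀ Ψ).symm
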